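/- Let $0<s<n$ be integers (so $n>1$) and let $\lambda\in\mathbb C\setminus\{0\}$ with $|\lambda|\neq 1$. On $\mathbb C^n$ put $b_{s,n}(z,w)=-\sum_{j=1}^s z_j\overline{w}_j+\sum_{j=s+1}^n z_j\overline{w}_j$ and $|z|_{s,n}=|b_{s,n}(z,z)|^{1/2}$. Let $\Lambda_0=\{z\in\mathbb C^n: b_{s,n}(z,z)=0\}$ (the null cone together with the origin), $\Lambda_+=\{z: b_{s,n}(z,z)\ge 0\}$ and $\Lambda_-=\{z: b_{s,n}(z,z)\le 0\}$, and let $G_\lambda=\{F_\lambda^m: m\in\mathbb Z\}$ be the group generated by the transformation $F_\lambda(z)=\lambda z$ of $\mathbb C^n\setminus\Lambda_0$. Then $G_\lambda$ acts freely on $\mathbb C^n\setminus\Lambda_0$ as a properly discontinuous group of holomorphic transformations; hence the quotient $\mathbb CH^n_s(\lambda)=(\mathbb C^n\setminus\Lambda_0)/G_\lambda$ is a complex manifold (Hausdorff and second countable, the projection being locally biholomorphic). The tensor field $$g_{s,n}=|z|_{s,n}^{-2}\Big(-\sum_{j=1}^s dz^j\odot d\overline z^j+\sum_{j=s+1}^n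 dz^j\odot d\overline z^j\Big),\qquad \alpha\odot\beta=\tfrac12(\alpha\otimes\beta+\beta\otimes\alpha),$$ descends to a globally defined semi-Riemannian metric of index $2s$ on $\mathbb CH^n_s(\lambda)$, which makes it an indefinite locally conformal Kähler manifold: $g_{s,n}$ is Hermitian, and every point has an open neighbourhood $U$ with a function $f\in C^\infty(U,\mathbb R)$ such that $e^{-f}g_{s,n}$ is an indefinite Kähler metric on $U$ (that is, Hermitian with $\nabla J=0$ for its Levi-Civita connection $\nabla$). Also $\partial\Lambda_+=\partial\Lambda_-=\Lambda_0$. Moreover, suppose that $\lambda$ is real with $0<\lambda<1$. Then $\mathbb CH^n_s(\lambda)$ is diffeomorphic to $\Sigma^{2n-1}\times S^1$, where $\Sigma^{2n-1}=\{z\in\mathbb C^n:|z|_{s,n}=1\}$, and $\mathbb CH^n_s(\lambda)$ is noncompact. It has exactly two connected components, $(\Lambda_+\setminus\Lambda_0)/G_\lambda$ and $(\Lambda_-\setminus\Lambda_0)/G_\lambda$; they are open, the first is diffeomorphic to $S^{2n-1}_{2s}\times S^1$ and the second to $H^{2n-1}_{2s-1}\times S^1$. Here, in $\mathbb R^{2n}$,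 $S^{2n-1}_{2s}=\{x:-\sum_{j\le 2s}x_j^2+\sum_{j>2s}x_j^2=1\}$ and $H^{2n-1}_{2s-1}=\{x:-\sum_{j\le 2s}x_j^2+\sum_{j>2s}x_j^2=-1\}$, and $\Sigma^{2n-1}$, $S^{2n-1}_{2s}$, $H^{2n-1}_{2s-1}$ are $(2n-1)$-dimensional embedded smooth submanifolds. -/

import Mathlib

open scoped Manifold ContDiff Topology
open Bundle

noncomputable section

/-! ### The Hermitian form `b_{s,n}`, the null cone and the hyperquadrics -/

/-- The complex vector space `ℂⁿ` (as a topological vector space; coordinates are `z 0, …, z (n-1)`). -/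
abbrev Cn (n : ℕ) : Type := EuclideanSpace ℂ (Fin n)

/-- The sign `ε_j`: `-1` for the first `s` indices, and `1` for the others. -/
def signEps (s : ℕ) {m : ℕ} (j : Fin m) : ℝ := if (j : ℕ) < s then -1 else 1

/-- The Hermitian form `b_{s,n}(z,w) = - ∑_{j ≤ s} z_j w̄_j + ∑_{j > s} z_j w̄_j`. -/
def hermB (n s : ℕ) (z w : Cn n) : ℂ :=
  ∑ j : Fin n, (signEps s j : ℂ) * (z j * (starRingEnd ℂ) (w j))

/-- The flat indefinite metric `- ∑_{j ≤ s} dz^j ⊙ dz̄^j + ∑_{j > s} dz^j ⊙ dz̄^j` on `ℂⁿ`.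
As `α ⊙ β = (α ⊗ β + β ⊗ α) / 2`, the term `dz^j ⊙ dz̄^j` takes the value
`(u_j v̄_j + v_j ū_j) / 2` on the real tangent vectors `u`, `v`, which is a real number. -/
def flatMetric (n s : ℕ) (u v : Cn n) : ℝ :=
  ∑ j : Fin n, signEps s j *
    ((u j * (starRingEnd ℂ) (v j) + v j * (starRingEnd ℂ) (u j)) / 2).re

/-- `|z|_{s,n} = |b_{s,n}(z,z)|^{1/2}`. -/
def pseudoNorm (n s : ℕ) (z : Cn n) : ℝ := Real.sqrt ‖hermB n s z z‖

/-- The null cone `Λ` (without the origin). -/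
def nullCone (n s : ℕ) : Set (Cn n) := {z | z ≠ 0 ∧ hermB n s z z = 0}

/-- `Λ₀ = Λ ∪ {0}`. -/
def nullCone₀ (n s : ℕ) : Set (Cn n) := nullCone n s ∪ {0}

/-- `Λ₊ = {z : b_{s,n}(z,z) ≥ 0}` (the value `b_{s,n}(z,z)` is real). -/
def posCone (n s : ℕ) : Set (Cn n) := {z | 0 ≤ (hermB n s z z).re}

/-- `Λ₋ = {z : b_{s,n}(z,z) ≤ 0}`. -/
def negCone (n s : ℕ) : Set (Cn n) := {z | (hermB n s z z).re ≤ 0}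

/-- `Σ^{2n-1} = {z ∈ ℂⁿ : |z|_{s,n} = 1}`. -/
def sigmaSet (n s : ℕ) : Set (Cn n) := {z | pseudoNorm n s z = 1}

/-- The form `h_{ν,m}(x,y) = - ∑_{j ≤ ν} x_j y_j + ∑_{j > ν} x_j y_j` on `ℝ^m`. -/
def realForm (ν m : ℕ) (x y : EuclideanSpace ℝ (Fin m)) : ℝ :=
  ∑ j : Fin m, signEps ν j * (x j * y j)

/-- The pseudosphere `S^N_ν(r)` in `ℝ^{N+1}`. -/
def pseudoSphere (N ν : ℕ) (r : ℝ) : Set (EuclideanSpace ℝ (Fin (N + 1))) :=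
  {x | realForm ν (N + 1) x x = r ^ 2}

/-- The pseudohyperbolic space `H^N_ν(r)` in `ℝ^{N+1}`. -/
def pseudoHyperbolic (N ν : ℕ) (r : ℝ) : Set (EuclideanSpace ℝ (Fin (N + 1))) :=
  {x | realForm (ν + 1) (N + 1) x x = - r ^ 2}

/-! ### The group `G_λ` and the quotient -/

lemma hermB_smul (n s : ℕ) (c : ℂ) (z : Cn n) :
    hermB n s (c • z) (c • z) = (c * (starRingEnd ℂ) c) * hermB n s z z := by
  simp only [hermB, Finset.mul_sum, PiLp.smul_apply, smul_eq_mul, map_mul]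
  exact Finset.sum_congr rfl fun j _ => by ring

lemma continuous_hermB (n s : ℕ) : Continuous fun z : Cn n => hermB n s z z := by
  unfold hermB
  fun_prop

lemma mem_nullCone₀ (n s : ℕ) (z : Cn n) : z ∈ nullCone₀ n s ↔ hermB n s z z = 0 := by
  by_cases hz : z = 0
  · subst hz
    simp [nullCone₀, hermB]
  · simp [nullCone₀, nullCone, hz]

/-- The open set `ℂⁿ \ Λ₀`. -/
def coneCompl (n s : ℕ) : TopologicalSpace.Opens (Cn n) where
  carrier := (nullCone₀ n s)ᶜ
  is_open' := by
    have h : (nullCone₀ n s)ᶜ = (fun z : Cn n => hermB n s z z) ⁻¹' {0}ᶜ := by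
      ext z
      simp [mem_nullCone₀]
    rw [h]
    exact isOpen_compl_singleton.preimage (continuous_hermB n s)

instance (n s : ℕ) : LocallyCompactSpace (coneCompl n s) :=
  (coneCompl n s).isOpen.locallyCompactSpace

lemma smul_mem_coneCompl {n s : ℕ} {c : ℂ} (hc : c ≠ 0) {z : Cn n} (hz : z ∈ coneCompl n s) :
    c • z ∈ coneCompl n s := by
  change c • z ∉ nullCone₀ n s
  change z ∉ nullCone₀ n s at hz
  rw [mem_nullCone₀] at hz ⊢
  rw [hermB_smul]
  simp [hc, hz]

/-- The transformation `F_λ(z) = λ z` of `ℂⁿ \ Λ₀`. -/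
def hopfMap (n s : ℕ) (lam : ℂ) (hlam : lam ≠ 0) : Equiv.Perm (coneCompl n s) where
  toFun z := ⟨lam • (z : Cn n), smul_mem_coneCompl hlam z.2⟩
  invFun z := ⟨lam⁻¹ • (z : Cn n), smul_mem_coneCompl (inv_ne_zero hlam) z.2⟩
  left_inv z := Subtype.ext (by simp [smul_smul, hlam])
  right_inv z := Subtype.ext (by simp [smul_smul, hlam])

/-- The group `G_λ = {F_λ^m : m ∈ ℤ}`, acting on `ℂⁿ \ Λ₀` by evaluation. -/
abbrev hopfGroup (n s : ℕ) (lam : ℂ) (hlam : lam ≠ 0) : Subgroup (Equiv.Perm (coneCompl n s)) :=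
  Subgroup.zpowers (hopfMap n s lam hlam)

/-- The quotient space `ℂHⁿ_s(λ) = (ℂⁿ \ Λ₀) / G_λ`, with the quotient topology. Once the action
is known to be free and properly discontinuous, its charts are the local inverses of the projection
(Mathlib's `MulAction.instChartedSpaceQuotient`). -/
abbrev HopfQuot (n s : ℕ) (lam : ℂ) (hlam : lam ≠ 0) : Type :=
  MulAction.orbitRel.Quotient (hopfGroup n s lam hlam) (coneCompl n s)

/-- The projection `π : ℂⁿ \ Λ₀ → ℂHⁿ_s(λ)`. -/
def hopfProj (n s : ℕ) (lam : ℂ) (hlam : lam ≠ 0) (z : coneCompl n s) : HopfQuot n s lam hlam :=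
  Quotient.mk (MulAction.orbitRel (hopfGroup n s lam hlam) (coneCompl n s)) z

/-! ### Indefinite Hermitian, Kähler and l.c.K. metrics

`M` is a complex manifold of complex dimension `n`. Its underlying real manifold is the same charted
space with the model `𝓘(ℝ, Cn n)`, so that real tangent vectors at `x` are elements of `Cn n`
(read in the preferred chart at `x`) and the complex structure is multiplication by `i`. -/

section LCK

variable {n : ℕ} {M : Type*} [TopologicalSpace M] [ChartedSpace (Cn n) M]

/-- The complex structure `J_x` on the real tangent space `T_x M`. -/
def tangentJ {x : M} (v : TangentSpace 𝓘(ℝ, Cn n) x) : TangentSpace 𝓘(ℝ, Cn n) x :=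
  (Complex.I • (show Cn n from v) : Cn n)

/-- A vector field, seen as a section of the tangent bundle, is differentiable at `x`. -/
def VFDiffAt [IsManifold 𝓘(ℝ, Cn n) ∞ M] (X : ∀ x : M, TangentSpace 𝓘(ℝ, Cn n) x) (x : M) : Prop :=
  MDifferentiableAt 𝓘(ℝ, Cn n) (𝓘(ℝ, Cn n).prod 𝓘(ℝ, Cn n))
    (fun y => TotalSpace.mk' (Cn n) y (X y) : M → TangentBundle 𝓘(ℝ, Cn n) M) x

variable (n M) in
/-- Fields of real bilinear forms on the tangent spaces of `M`. -/
abbrev BilinField : Type _ :=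
  ∀ x : M, TangentSpace 𝓘(ℝ, Cn n) x →L[ℝ] TangentSpace 𝓘(ℝ, Cn n) x →L[ℝ] ℝ

/-- The index of the symmetric bilinear form `g x`: the largest dimension of a subspace on which it
is negative definite. -/
def metricIndex (g : BilinField n M) (x : M) : ℕ :=
  _root_.sigNeg (LinearMap.BilinMap.toQuadraticMap (g x).toLinearMap₁₂)

/-- `g` is an indefinite Hermitian metric of index `ν`, `0 < ν < 2n`, on the open set `U`: a smooth
semi-Riemannian metric of index `ν` with `g(JX, JY) = g(X, Y)`. -/
structure IsIndefiniteHermitianOn [IsManifold 𝓘(ℂ, Cn n) ω M] [IsManifold 𝓘(ℝ, Cn n) ∞ M]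
    (g : BilinField n M) (ν : ℕ) (U : Set M) : Prop where
  index_pos : 0 < ν
  index_lt : ν < 2 * n
  smooth : ContMDiffOn 𝓘(ℝ, Cn n) (𝓘(ℝ, Cn n).prod 𝓘(ℝ, Cn n →L[ℝ] Cn n →L[ℝ] ℝ)) ∞
    (fun x => TotalSpace.mk' (Cn n →L[ℝ] Cn n →L[ℝ] ℝ)
      (E := fun x : M => TangentSpace 𝓘(ℝ, Cn n) x →L[ℝ] TangentSpace 𝓘(ℝ, Cn n) x →L[ℝ] ℝ)
      x (g x)) U
  symm : ∀ x ∈ U, ∀ u v, g x u v = g x v u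
  nondegenerate : ∀ x ∈ U, ∀ u, (∀ v, g x u v = 0) → u = 0
  index_eq : ∀ x ∈ U, metricIndex g x = ν
  hermitian : ∀ x ∈ U, ∀ u v, g x (tangentJ u) (tangentJ v) = g x u v

/-- `cov` is the Levi-Civita connection of `g` on the open set `U`: a torsion-free covariant
derivative which is compatible with `g`. Here `cov Y x (X x)` is `(∇_X Y)(x)`. -/
structure IsLeviCivitaOn [IsManifold 𝓘(ℝ, Cn n) ∞ M] (g : BilinField n M)
    (cov : (∀ x : M, TangentSpace 𝓘(ℝ, Cn n) x) →
      (∀ x : M, TangentSpace 𝓘(ℝ, Cn n) x →L[ℝ] TangentSpace 𝓘(ℝ, Cn n) x))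
    (U : Set M) : Prop where
  isCovariantDerivativeOn : IsCovariantDerivativeOn (Cn n) cov U
  torsion_free : ∀ X Y, ∀ x ∈ U, VFDiffAt X x → VFDiffAt Y x →
    cov Y x (X x) - cov X x (Y x) = VectorField.mlieBracket 𝓘(ℝ, Cn n) X Y x
  metric : ∀ Y Z, ∀ x ∈ U, VFDiffAt Y x → VFDiffAt Z x → ∀ v : TangentSpace 𝓘(ℝ, Cn n) x,
    (show ℝ from mfderiv 𝓘(ℝ, Cn n) 𝓘(ℝ, ℝ) (fun y => g y (Y y) (Z y)) x v) =
      g x (cov Y x v) (Z x) + g x (Y x) (cov Z x v)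

/-- `(U, g)` is an indefinite Kähler manifold (of index `ν`): `g` is indefinite Hermitian and its
Levi-Civita connection satisfies `∇ J = 0`. -/
def IsIndefiniteKahlerOn [IsManifold 𝓘(ℂ, Cn n) ω M] [IsManifold 𝓘(ℝ, Cn n) ∞ M]
    (g : BilinField n M) (ν : ℕ) (U : Set M) : Prop :=
  IsIndefiniteHermitianOn g ν U ∧
    ∃ cov : (∀ x : M, TangentSpace 𝓘(ℝ, Cn n) x) →
        (∀ x : M, TangentSpace 𝓘(ℝ, Cn n) x →L[ℝ] TangentSpace 𝓘(ℝ, Cn n) x),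
      IsLeviCivitaOn g cov U ∧
      ∀ Y, ∀ x ∈ U, VFDiffAt Y x → ∀ v : TangentSpace 𝓘(ℝ, Cn n) x,
        cov (fun y => tangentJ (Y y)) x v = tangentJ (cov Y x v)

/-- `g` is an indefinite locally conformal Kähler metric of index `ν` on `M`: it is an indefinite
Hermitian metric, and each point has an open neighbourhood `U` with a smooth `f : U → ℝ` such that
`(U, e^{-f} g)` is an indefinite Kähler manifold. -/
def IsIndefiniteLCK [IsManifold 𝓘(ℂ, Cn n) ω M] [IsManifold 𝓘(ℝ, Cn n) ∞ M]
    (g : BilinField n M) (ν : ℕ) : Prop :=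
  IsIndefiniteHermitianOn g ν Set.univ ∧
    ∀ x : M, ∃ U : Set M, IsOpen U ∧ x ∈ U ∧
      ∃ f : M → ℝ, ContMDiffOn 𝓘(ℝ, Cn n) 𝓘(ℝ, ℝ) ∞ f U ∧
        IsIndefiniteKahlerOn (fun y => Real.exp (-(f y)) • g y) ν U

end LCK

/-- `M ≈ S × S¹`, where the subset `S` of the real vector space `V` is a `k`-dimensional embedded
smooth submanifold: `S` (with the subspace topology) carries a smooth structure for which the
inclusion is a smooth embedding (such a structure is unique), and `M` is diffeomorphic to the product
of this manifold with the circle. -/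
def DiffeoProdCircle {V : Type*} [NormedAddCommGroup V] [NormedSpace ℝ V] (k : ℕ) (S : Set V)
    {E : Type*} [NormedAddCommGroup E] [NormedSpace ℝ E]
    (M : Type*) [TopologicalSpace M] [ChartedSpace E M] : Prop :=
  ∃ _ : ChartedSpace (EuclideanSpace ℝ (Fin k)) S,
    IsManifold (𝓡 k) ∞ S ∧
    Manifold.IsSmoothEmbedding (𝓡 k) 𝓘(ℝ, V) ∞ (Subtype.val : S → V) ∧
    Nonempty (M ≃ₘ⟮𝓘(ℝ, E), (𝓡 k).prod (𝓡 1)⟯ (S × Circle))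

end

/-! The proof rests on one homogeneity: for complex `c`, both Q(z) = b(z,z), here `hermQ`, and the
flat metric are multiplied by |c|² under z ↦ cz. Since |λ| ≠ 1, comparing Euclidean norms shows that
a power of λ fixes no point and that only finitely many powers carry one compact set to meet
another.

The charts of the quotient are local sections of the projection, so two of them differ locally by
multiplication by a constant power of λ (`IsLiftChart.eventually_eq_smul`). Transition maps are thus
locally complex linear homotheties. Differentiating vector fields in these charts is therefore
independent of the chart: it gives a torsion-free connection `flatCov` that commutes with J. The
flat metric is defined only up to the factors |c|², and dividing by |Q| removes this ambiguity.
Conversely, on the domain of one chart, e^{-f} = |Q| turns the metric back into the flat one, up to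
locally constant factors in the other charts. `flatCov` is then its Levi-Civita connection, which
proves the l.c.K. property (`isIndefiniteLCK_hopfMetric`).

The null cone is the common boundary because, at a zero of Q, enlarging the modulus of one
coordinate moves Q in the direction of that coordinate's sign.

For λ = r in (0,1) all three product decompositions are instances of
`IsConeQuotient.diffeoProdCircle`. If N is positively homogeneous of degree one and smooth where
positive, then x ↦ (x / N(x), exp(2πi log N(x) / log r)) identifies {N > 0} modulo r with {N = 1} ×
S¹; the inverse sends (y, exp(2πit)) to the class of r^t y. Here N is √|Q|, √Q or √(-Q). The sets Q
> 0 and Q < 0 are connected by shrinking the coordinates of the wrong sign, and their images are the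
two components. The quotient is noncompact because ‖z‖²/|Q(z)| is invariant, continuous and
unbounded. -/

noncomputable section

/-- The real quadratic form `z ↦ b_{s,n}(z,z)`. -/
def hermQ (n s : ℕ) (z : Cn n) : ℝ := ∑ j : Fin n, signEps s j * ‖z j‖ ^ 2

lemma hermB_self (n s : ℕ) (z : Cn n) : hermB n s z z = (hermQ n s z : ℂ) := by
  simp only [hermB, hermQ, Complex.mul_conj, Complex.normSq_eq_norm_sq]
  push_cast
  rfl

lemma contDiff_hermQ (n s : ℕ) : ContDiff ℝ ∞ (hermQ n s) := by
  have h : ∀ j : Fin n, ContDiff ℝ ∞ fun z : Cn n => z j := fun j =>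
    ((EuclideanSpace.proj j : Cn n →L[ℂ] ℂ).restrictScalars ℝ).contDiff
  exact ContDiff.sum fun j _ => contDiff_const.mul ((h j).norm_sq ℝ)

lemma continuous_hermQ (n s : ℕ) : Continuous (hermQ n s) := (contDiff_hermQ n s).continuous

lemma hermQ_smul (n s : ℕ) (c : ℂ) (z : Cn n) : hermQ n s (c • z) = ‖c‖ ^ 2 * hermQ n s z := by
  simp only [hermQ, Finset.mul_sum, PiLp.smul_apply, smul_eq_mul, norm_mul]
  exact Finset.sum_congr rfl fun j _ => by ring

lemma pseudoNorm_eq (n s : ℕ) (z : Cn n) : pseudoNorm n s z = √|hermQ n s z| := by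
  rw [pseudoNorm, hermB_self, Complex.norm_real, Real.norm_eq_abs]

lemma pseudoNorm_sq (n s : ℕ) (z : Cn n) : pseudoNorm n s z ^ 2 = |hermQ n s z| := by
  rw [pseudoNorm_eq, Real.sq_sqrt (abs_nonneg _)]

lemma mem_nullCone₀_iff (n s : ℕ) (z : Cn n) : z ∈ nullCone₀ n s ↔ hermQ n s z = 0 := by
  rw [mem_nullCone₀, hermB_self, Complex.ofReal_eq_zero]

lemma mem_coneCompl_iff (n s : ℕ) (z : Cn n) : z ∈ coneCompl n s ↔ hermQ n s z ≠ 0 :=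
  (mem_nullCone₀_iff n s z).not

lemma mem_posCone_iff (n s : ℕ) (z : Cn n) : z ∈ posCone n s ↔ 0 ≤ hermQ n s z := by
  change 0 ≤ (hermB n s z z).re ↔ _
  rw [hermB_self, Complex.ofReal_re]

lemma mem_negCone_iff (n s : ℕ) (z : Cn n) : z ∈ negCone n s ↔ hermQ n s z ≤ 0 := by
  change (hermB n s z z).re ≤ 0 ↔ _
  rw [hermB_self, Complex.ofReal_re]

lemma hermQ_zero (n s : ℕ) : hermQ n s 0 = 0 := by simp [hermQ]

lemma coneCompl_ne_zero {n s : ℕ} {z : Cn n} (hz : z ∈ coneCompl n s) : z ≠ 0 := by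
  rintro rfl
  exact (mem_coneCompl_iff n s 0).1 hz (hermQ_zero n s)

lemma pseudoNorm_pos_iff (n s : ℕ) (z : Cn n) : 0 < pseudoNorm n s z ↔ z ∈ coneCompl n s := by
  rw [mem_coneCompl_iff, pseudoNorm_eq, Real.sqrt_pos, abs_pos]

/-! ### The flat metric as a continuous bilinear form -/

lemma flatMetric_eq (n s : ℕ) (u v : Cn n) :
    flatMetric n s u v = ∑ j, signEps s j * (u j * (starRingEnd ℂ) (v j)).re := by
  refine Finset.sum_congr rfl fun j _ => ?_
  congr 1
  simp
  ring

/-- The flat metric, as a continuous bilinear form. -/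
def flatB (n s : ℕ) : Cn n →L[ℝ] Cn n →L[ℝ] ℝ :=
  LinearMap.toContinuousBilinearMap <| LinearMap.mk₂ ℝ (flatMetric n s)
    (fun u u' v => by
      simp only [flatMetric_eq, ← Finset.sum_add_distrib]
      exact Finset.sum_congr rfl fun j _ => by simp; ring)
    (fun c u v => by
      simp only [flatMetric_eq, Finset.smul_sum]
      exact Finset.sum_congr rfl fun j _ => by
        simp only [PiLp.smul_apply, Complex.real_smul, smul_eq_mul, mul_assoc, Complex.re_ofReal_mul]
        ring)
    (fun u v v' => by
      simp only [flatMetric_eq, ← Finset.sum_add_distrib]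
      exact Finset.sum_congr rfl fun j _ => by simp; ring)
    (fun c u v => by
      simp only [flatMetric_eq, Finset.smul_sum]
      exact Finset.sum_congr rfl fun j _ => by
        simp only [PiLp.smul_apply, Complex.real_smul, smul_eq_mul, map_mul, Complex.conj_ofReal,
          mul_left_comm (u j), Complex.re_ofReal_mul]
        ring)

lemma flatMetric_comm (n s : ℕ) (u v : Cn n) : flatMetric n s u v = flatMetric n s v u := by
  exact Finset.sum_congr rfl fun j _ => by rw [add_comm]

/-- With c a power of λ this is the ambiguity of the flat metric between charts; with c = i it gives
the Hermitian property. -/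
lemma flatMetric_smul_smul (n s : ℕ) (c : ℂ) (u v : Cn n) :
    flatMetric n s (c • u) (c • v) = ‖c‖ ^ 2 * flatMetric n s u v := by
  simp only [flatMetric_eq, Finset.mul_sum, PiLp.smul_apply, smul_eq_mul,
    ← Complex.normSq_eq_norm_sq, Complex.normSq_apply]
  exact Finset.sum_congr rfl fun j _ => by simp; ring

lemma signEps_mul_self (s : ℕ) {m : ℕ} (j : Fin m) : signEps s j * signEps s j = 1 := by
  unfold signEps; split_ifs <;> norm_num

lemma flatMetric_nondegenerate (n s : ℕ) (u : Cn n) (h : ∀ v, flatMetric n s u v = 0) : u = 0 := by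
  -- The test vector is u with the signs ε_j inserted, so that the pairing becomes ∑ |u_j|².
  have h1 := h (WithLp.toLp 2 fun j => (signEps s j : ℂ) * u j)
  have h2 : ∑ j, ‖u j‖ ^ 2 = 0 := by
    rw [← h1, flatMetric_eq]
    refine Finset.sum_congr rfl fun j _ => ?_
    have h3 := signEps_mul_self s j
    rw [← Complex.normSq_eq_norm_sq, Complex.normSq_apply]
    simp
    linear_combination (-((u j).re ^ 2 + (u j).im ^ 2)) * h3
  ext j
  have := (Finset.sum_eq_zero_iff_of_nonneg fun j _ => sq_nonneg ‖u j‖).1 h2 j (Finset.mem_univ j)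
  simpa using this

lemma flatMetric_self (n s : ℕ) (u : Cn n) : flatMetric n s u u = hermQ n s u := by
  rw [flatMetric_eq, hermQ]
  refine Finset.sum_congr rfl fun j _ => ?_
  rw [Complex.mul_conj, Complex.ofReal_re, Complex.normSq_eq_norm_sq]

/-- Real coordinates on `ℂⁿ`. -/
def realCoords (n : ℕ) : Cn n ≃ₗ[ℝ] (Fin n × Fin 2 → ℝ) where
  toFun z p := if p.2 = 0 then (z p.1).re else (z p.1).im
  invFun x := WithLp.toLp 2 fun j => ⟨x (j, 0), x (j, 1)⟩
  map_add' z w := by ext p; by_cases h : p.2 = 0 <;> simp [h]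
  map_smul' c z := by ext p; by_cases h : p.2 = 0 <;> simp [h]
  left_inv z := by ext j; simp
  right_inv x := by
    ext ⟨j, i⟩
    fin_cases i <;> simp

lemma ncard_neg_signEps {n s : ℕ} (hsn : s ≤ n) :
    {p : Fin n × Fin 2 | signEps s p.1 < 0}.ncard = 2 * s := by
  have h1 : {p : Fin n × Fin 2 | signEps s p.1 < 0} =
      ((Finset.univ.filter fun j : Fin n => (j : ℕ) < s) ×ˢ (Finset.univ : Finset (Fin 2)) :
        Finset (Fin n × Fin 2)) := by
    ext p
    simp only [signEps, Set.mem_ofPred_eq, Finset.coe_product, Set.mem_prod, Finset.mem_coe,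
      Finset.mem_filter, Finset.mem_univ, true_and, and_true]
    split_ifs with h <;> simp [h]
  rw [h1, Set.ncard_coe_finset, Finset.card_product, Fin.card_filter_val_lt]
  simp [min_eq_right hsn, mul_comm]

/-- The form is diagonal in the real and imaginary parts, so the index counts negative weights: two
for each of the first s complex coordinates. A positive factor changes no sign. -/
lemma sigNeg_flatMetric {n s : ℕ} (hsn : s ≤ n) {c : ℝ} (hc : 0 < c)
    (Q : QuadraticForm ℝ (Cn n)) (hQ : ∀ u, Q u = c * flatMetric n s u u) :
    _root_.sigNeg Q = 2 * s := by
  have e : QuadraticMap.Equivalent Q (QuadraticMap.weightedSumSquares ℝ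
      fun p : Fin n × Fin 2 => c * signEps s p.1) := by
    refine ⟨⟨realCoords n, fun u => ?_⟩⟩
    rw [QuadraticMap.weightedSumSquares_apply, hQ, flatMetric_self, hermQ,
      Fintype.sum_prod_type, Finset.mul_sum]
    refine Finset.sum_congr rfl fun j _ => ?_
    rw [← Complex.normSq_eq_norm_sq, Complex.normSq_apply]
    simp [realCoords]
    ring
  rw [e.sigNeg_eq, QuadraticForm.sigNeg_weightedSumSquares, ← ncard_neg_signEps hsn]
  congr 1
  ext p
  simp only [Set.mem_ofPred_eq]
  exact ⟨fun h => by by_contra h'; exact absurd h (not_lt.2 (mul_nonneg hc.le (not_lt.1 h'))),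
    fun h => mul_neg_of_pos_of_neg hc h⟩

/-! ### The topology of the cones -/

/-- Only the j-th coordinate is moved, radially outwards (in an arbitrary direction if it vanishes),
so its modulus grows exactly by t. -/
lemma exists_hermQ_add_smul {n : ℕ} (s : ℕ) (z : Cn n) (j : Fin n) :
    ∃ v : Cn n, ∀ t : ℝ, 0 ≤ t →
      hermQ n s (z + t • v) = hermQ n s z + signEps s j * (2 * ‖z j‖ * t + t ^ 2) := by
  obtain ⟨u, hu⟩ : ∃ u : ℂ, ∀ t : ℝ, 0 ≤ t → ‖z j + t • u‖ = ‖z j‖ + t := by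
    by_cases h : z j = 0
    · exact ⟨1, fun t ht => by simp [h, abs_of_nonneg ht]⟩
    · refine ⟨‖z j‖⁻¹ • z j, fun t ht => ?_⟩
      have h' := norm_pos_iff.2 h
      have : z j + t • (‖z j‖⁻¹ • z j) = (1 + t * ‖z j‖⁻¹) • z j := by
        rw [add_smul, one_smul, mul_smul]
      rw [this, norm_smul, Real.norm_of_nonneg (by positivity)]
      field_simp
  refine ⟨EuclideanSpace.single j u, fun t ht => ?_⟩
  rw [hermQ, hermQ, ← sub_eq_iff_eq_add', ← Finset.sum_sub_distrib,
    Finset.sum_eq_single j]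
  · have : (z + t • EuclideanSpace.single j u : Cn n) j = z j + t • u := by simp
    rw [this, hu t ht]
    ring
  · intro i _ hi
    have : (z + t • EuclideanSpace.single j u : Cn n) i = z i := by simp [hi]
    rw [this, sub_self]
  · simp

lemma frequently_sign_hermQ {n : ℕ} (s : ℕ) {z : Cn n} (hz : hermQ n s z = 0) (j : Fin n) :
    ∃ᶠ w in 𝓝 z, 0 < signEps s j * hermQ n s w := by
  obtain ⟨v, hv⟩ := exists_hermQ_add_smul s z j
  have ht : Filter.Tendsto (fun t : ℝ => z + t • v) (𝓝[>] 0) (𝓝 z) := by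
    have : Continuous fun t : ℝ => z + t • v := by fun_prop
    simpa using (this.tendsto 0).mono_left nhdsWithin_le_nhds
  refine ht.frequently (Filter.Eventually.frequently ?_)
  filter_upwards [self_mem_nhdsWithin] with t ht
  have ht : 0 < t := ht
  rw [hv t ht.le, hz, zero_add, ← mul_assoc, signEps_mul_self]
  positivity

lemma frontier_posCone {n s : ℕ} (hs : 0 < s) (hsn : s < n) :
    frontier (posCone n s) = nullCone₀ n s := by
  have h : posCone n s = {z | 0 ≤ hermQ n s z} := Set.ext (mem_posCone_iff n s)
  apply Set.Subset.antisymm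
  · intro z hz
    rw [h] at hz
    exact (mem_nullCone₀_iff n s z).2
      (frontier_le_subset_eq continuous_const (continuous_hermQ n s) hz).symm
  · intro z hz
    rw [mem_nullCone₀_iff] at hz
    refine ⟨subset_closure ((mem_posCone_iff n s z).2 hz.ge), fun hi => ?_⟩
    rw [mem_interior_iff_mem_nhds] at hi
    -- Coordinate 0 has sign -1 because s > 0, so points with Q < 0 accumulate at z. The opposite
    -- case below uses coordinate s.
    have hf := frequently_sign_hermQ s hz ⟨0, hs.trans hsn⟩
    obtain ⟨w, hw, hw'⟩ := (hf.and_eventually hi).exists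
    replace hw' := (mem_posCone_iff n s w).1 hw'
    simp only [signEps, hs, if_true] at hw
    linarith

lemma frontier_negCone {n s : ℕ} (hsn : s < n) :
    frontier (negCone n s) = nullCone₀ n s := by
  have h : negCone n s = {z | hermQ n s z ≤ 0} := Set.ext (mem_negCone_iff n s)
  apply Set.Subset.antisymm
  · intro z hz
    rw [h] at hz
    exact (mem_nullCone₀_iff n s z).2
      (frontier_le_subset_eq (continuous_hermQ n s) continuous_const hz)
  · intro z hz
    rw [mem_nullCone₀_iff] at hz
    refine ⟨subset_closure ((mem_negCone_iff n s z).2 hz.le), fun hi => ?_⟩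
    rw [mem_interior_iff_mem_nhds] at hi
    have hf := frequently_sign_hermQ s hz ⟨s, hsn⟩
    obtain ⟨w, hw, hw'⟩ := (hf.and_eventually hi).exists
    replace hw' := (mem_negCone_iff n s w).1 hw'
    simp only [signEps, lt_irrefl, if_false] at hw
    linarith

/-- Scaling the coordinates of nonpositive weight down to 0 never decreases the form, so each point
is joined inside the set to a nonzero vector supported on the positive coordinates. Those vectors
form a punctured space of real dimension at least 2, which is connected. -/
lemma isConnected_setOf_weighted_pos {n : ℕ} (ε : Fin n → ℝ) (j₀ : Fin n) (hj₀ : 0 < ε j₀) :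
    IsConnected {z : Cn n | 0 < ∑ j, ε j * ‖z j‖ ^ 2} := by
  classical
  set Q : Cn n → ℝ := fun z => ∑ j, ε j * ‖z j‖ ^ 2
  let ι : ({j // 0 < ε j} → ℂ) → Cn n := fun x =>
    WithLp.toLp 2 fun j => if h : 0 < ε j then x ⟨j, h⟩ else 0
  have hι : Continuous ι := by
    refine (PiLp.continuous_toLp 2 _).comp (continuous_pi fun j => ?_)
    by_cases h : 0 < ε j
    · simpa [h] using continuous_apply _
    · simpa [h] using continuous_const
  have hrank : 1 < Module.rank ℝ ({j // 0 < ε j} → ℂ) := by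
    rw [← Module.finrank_eq_rank, Module.finrank_pi_fintype]
    simp only [Complex.finrank_real_complex, Finset.sum_const, Finset.card_univ, smul_eq_mul]
    have : 0 < Fintype.card {j // 0 < ε j} := Fintype.card_pos_iff.2 ⟨⟨j₀, hj₀⟩⟩
    exact_mod_cast (by omega : 1 < Fintype.card {j // 0 < ε j} * 2)
  have hT : IsConnected (ι '' {0}ᶜ) :=
    (isConnected_compl_singleton_of_one_lt_rank hrank 0).image _ hι.continuousOn
  have hTQ : ι '' {0}ᶜ ⊆ {z | 0 < Q z} := by
    rintro _ ⟨x, hx, rfl⟩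
    obtain ⟨i, hi⟩ := Function.ne_iff.1 (show x ≠ 0 from hx)
    change 0 < ∑ j, ε j * ‖ι x j‖ ^ 2
    refine Finset.sum_pos' (fun j _ => ?_) ⟨i.1, Finset.mem_univ _, ?_⟩
    · by_cases h : 0 < ε j
      · positivity
      · simp [ι, h]
    · have : 0 < ‖x i‖ := norm_pos_iff.2 hi
      have h2 := i.2
      simp only [ι, h2, dif_pos]
      positivity
  obtain ⟨p, hp⟩ := hT.nonempty
  refine ⟨⟨p, hTQ hp⟩, isPreconnected_of_forall p fun z hz => ?_⟩
  let γ : ℝ → Cn n := fun t => WithLp.toLp 2 fun j => if 0 < ε j then z j else t • z j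
  have hγ : Continuous γ := by
    refine (PiLp.continuous_toLp 2 _).comp (continuous_pi fun j => ?_)
    by_cases h : 0 < ε j
    · simpa [h] using continuous_const
    · simp only [h, if_false]
      fun_prop
  have hγQ : ∀ t ∈ Set.Icc (0 : ℝ) 1, 0 < Q (γ t) := by
    intro t ht
    refine lt_of_lt_of_le hz (Finset.sum_le_sum fun j _ => ?_)
    by_cases h : 0 < ε j
    · simp [γ, h]
    · simp only [γ, h, if_false, norm_smul, mul_pow]
      have h1 : ‖t‖ ^ 2 ≤ 1 := by
        rw [Real.norm_of_nonneg ht.1]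
        exact pow_le_one₀ ht.1 ht.2
      have h2 : ε j * ‖z j‖ ^ 2 ≤ 0 := mul_nonpos_of_nonpos_of_nonneg (not_lt.1 h) (by positivity)
      nlinarith
  have h1 : γ 1 = z := by ext j; simp [γ]
  have h0 : γ 0 = ι fun j => z j := by
    ext j
    by_cases h : 0 < ε j <;> simp [γ, ι, h]
  have hmem : γ 0 ∈ ι '' {0}ᶜ := by
    have hx : (fun j => z j.1) ∈ ({0}ᶜ : Set ({j // 0 < ε j} → ℂ)) := fun hx => by
      have := hγQ 0 (by simp)
      rw [h0, Set.mem_singleton_iff.1 hx] at this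
      simp [Q, ι] at this
    exact h0 ▸ ⟨_, hx, rfl⟩
  refine ⟨ι '' {0}ᶜ ∪ γ '' Set.Icc 0 1, ?_, Or.inl hp, Or.inr ⟨1, by simp, h1⟩, ?_⟩
  · rintro w (hw | ⟨t, ht, rfl⟩)
    · exact hTQ hw
    · exact hγQ t ht
  · exact IsPreconnected.union (γ 0) hmem ⟨0, by simp, rfl⟩ hT.isPreconnected
      (isPreconnected_Icc.image _ hγ.continuousOn)

lemma isConnected_hermQ_pos {n s : ℕ} (hsn : s < n) :
    IsConnected {z : Cn n | 0 < hermQ n s z} :=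
  isConnected_setOf_weighted_pos _ ⟨s, hsn⟩ (by simp [signEps])

lemma isConnected_hermQ_neg {n s : ℕ} (hs : 0 < s) (hsn : s < n) :
    IsConnected {z : Cn n | hermQ n s z < 0} := by
  have h := isConnected_setOf_weighted_pos (fun j : Fin n => -signEps s j) ⟨0, hs.trans hsn⟩
    (by simp [signEps, hs])
  simpa [hermQ] using h

end

noncomputable section

/-! ### The action of `G_λ` -/

variable {n s : ℕ} {lam : ℂ} {hlam : lam ≠ 0}

lemma coe_hopfMap_zpow (m : ℤ) (z : coneCompl n s) :
    (((hopfMap n s lam hlam ^ m) z : coneCompl n s) : Cn n) = lam ^ m • (z : Cn n) := by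
  induction m using Int.induction_on generalizing z with
  | zero => simp
  | succ k ih =>
    rw [zpow_add_one, Equiv.Perm.mul_apply, ih, zpow_add_one₀ hlam, mul_smul]
    rfl
  | pred k ih =>
    rw [zpow_sub_one, Equiv.Perm.mul_apply, ih, zpow_sub_one₀ hlam, mul_smul]
    rfl

lemma exists_zpow_smul (γ : hopfGroup n s lam hlam) :
    ∃ m : ℤ, hopfMap n s lam hlam ^ m = γ ∧
      ∀ z : coneCompl n s, ((γ • z : coneCompl n s) : Cn n) = lam ^ m • (z : Cn n) := by
  obtain ⟨m, hm⟩ := Subgroup.mem_zpowers_iff.1 γ.2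
  refine ⟨m, hm, fun z => ?_⟩
  rw [← coe_hopfMap_zpow (hlam := hlam) m z, hm]
  rfl

lemma exists_smul_eq_zpow (hlam : lam ≠ 0) (m : ℤ) (z : coneCompl n s) :
    ∃ γ : hopfGroup n s lam hlam, ((γ • z : coneCompl n s) : Cn n) = lam ^ m • (z : Cn n) :=
  ⟨⟨hopfMap n s lam hlam ^ m, Subgroup.zpow_mem_zpowers _ m⟩, coe_hopfMap_zpow m z⟩

lemma zpow_norm_injective (hlam : lam ≠ 0) (hlam1 : ‖lam‖ ≠ 1) :
    Function.Injective fun m : ℤ => ‖lam‖ ^ m :=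
  zpow_right_injective₀ (norm_pos_iff.2 hlam) hlam1

lemma hopfGroup_free (hlam1 : ‖lam‖ ≠ 1) (γ : hopfGroup n s lam hlam) (z : coneCompl n s)
    (h : γ • z = z) : γ = 1 := by
  obtain ⟨m, hm, hγ⟩ := exists_zpow_smul γ
  have h1 : ‖lam ^ m • (z : Cn n)‖ = ‖(z : Cn n)‖ := by rw [← hγ, h]
  rw [norm_smul, norm_zpow] at h1
  have h2 : ‖lam‖ ^ m = ‖lam‖ ^ (0 : ℤ) := by
    rw [zpow_zero]
    exact mul_right_cancel₀ (norm_ne_zero_iff.2 (coneCompl_ne_zero z.2)) (by rw [h1, one_mul])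
  have h3 : m = 0 := zpow_norm_injective hlam hlam1 h2
  rw [h3, zpow_zero] at hm
  exact Subtype.ext hm.symm

lemma isCancelSMul_hopfGroup (hlam1 : ‖lam‖ ≠ 1) :
    IsCancelSMul (hopfGroup n s lam hlam) (coneCompl n s) where
  right_cancel' γ γ' z h := by
    have := hopfGroup_free hlam1 (γ'⁻¹ * γ) z (by rw [mul_smul, h, inv_smul_smul])
    rwa [inv_mul_eq_one, eq_comm] at this

lemma continuousConstSMul_hopfGroup :
    ContinuousConstSMul (hopfGroup n s lam hlam) (coneCompl n s) where
  continuous_const_smul γ := by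
    obtain ⟨m, -, hγ⟩ := exists_zpow_smul γ
    refine continuous_induced_rng.2 ?_
    have : (Subtype.val ∘ fun z : coneCompl n s => γ • z) =
        fun z : coneCompl n s => lam ^ m • (z : Cn n) :=
      funext hγ
    rw [this]
    fun_prop

/-- Taking logarithms bounds |m| by a constant over |log r|, which is nonzero. -/
lemma finite_setOf_zpow_mem_Icc {r : ℝ} (hr : 0 < r) (hr1 : r ≠ 1) {a b : ℝ} (ha : 0 < a) :
    {m : ℤ | r ^ m ∈ Set.Icc a b}.Finite := by
  have hlog : Real.log r ≠ 0 := Real.log_ne_zero_of_pos_of_ne_one hr hr1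
  set C := max |Real.log a| |Real.log b|
  refine (Set.finite_Icc (-⌈C / |Real.log r|⌉) ⌈C / |Real.log r|⌉).subset fun m hm => ?_
  have h1 : Real.log a ≤ m * Real.log r := by
    rw [← Real.log_zpow]
    exact Real.log_le_log ha hm.1
  have h2 : m * Real.log r ≤ Real.log b := by
    rw [← Real.log_zpow]
    exact Real.log_le_log (zpow_pos hr m) hm.2
  have h3 : |(m : ℝ)| * |Real.log r| ≤ C := by
    rw [← abs_mul]
    exact abs_le_max_abs_abs h1 h2
  rw [← le_div_iff₀ (abs_pos.2 hlog)] at h3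
  have h4 : |m| ≤ ⌈C / |Real.log r|⌉ := by
    exact_mod_cast (h3.trans (Int.le_ceil _) : |(m : ℝ)| ≤ _)
  exact abs_le.1 h4

lemma properlyDiscontinuousSMul_hopfGroup (hlam1 : ‖lam‖ ≠ 1) :
    ProperlyDiscontinuousSMul (hopfGroup n s lam hlam) (coneCompl n s) where
  finite_disjoint_inter_image {K L} hK hL := by
    have hb : ∀ K : Set (coneCompl n s), IsCompact K → ∃ a b : ℝ, 0 < a ∧ 0 < b ∧
        ∀ z ∈ K, a ≤ ‖(z : Cn n)‖ ∧ ‖(z : Cn n)‖ ≤ b := by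
      intro K hK
      rcases K.eq_empty_or_nonempty with rfl | hne
      · exact ⟨1, 1, one_pos, one_pos, by simp⟩
      have hc : ContinuousOn (fun z : coneCompl n s => ‖(z : Cn n)‖) K := by fun_prop
      obtain ⟨x, -, hx⟩ := hK.exists_isMinOn hne hc
      obtain ⟨y, -, hy⟩ := hK.exists_isMaxOn hne hc
      exact ⟨_, _, norm_pos_iff.2 (coneCompl_ne_zero x.2), norm_pos_iff.2 (coneCompl_ne_zero y.2),
        fun z hz => ⟨hx hz, hy hz⟩⟩
    obtain ⟨a, b, ha, hb', hab⟩ := hb K hK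
    obtain ⟨c, d, hc, hd, hcd⟩ := hb L hL
    -- Norms lie in [a, b] on K and in [c, d] on L, so a power of λ taking a point of K into L has
    -- modulus in [c/b, d/a].
    have hfin := finite_setOf_zpow_mem_Icc (norm_pos_iff.2 hlam) hlam1 (a := c / b) (b := d / a)
      (by positivity)
    refine (hfin.image fun m => (⟨hopfMap n s lam hlam ^ m, Subgroup.zpow_mem_zpowers _ m⟩ :
      hopfGroup n s lam hlam)).subset ?_
    rintro γ hγ
    obtain ⟨w, ⟨z, hz, rfl⟩, hw⟩ := hγ
    obtain ⟨m, hm, hγm⟩ := exists_zpow_smul γ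
    refine ⟨m, ?_, Subtype.ext hm⟩
    have h1 := hcd _ hw
    have h2 := hab z hz
    simp only [hγm, norm_smul, norm_zpow] at h1
    have h3 : 0 < ‖(z : Cn n)‖ := ha.trans_le h2.1
    have h4 : 0 < ‖lam‖ ^ m := zpow_pos (norm_pos_iff.2 hlam) m
    constructor
    · rw [div_le_iff₀ hb']
      nlinarith
    · rw [le_div_iff₀ ha]
      nlinarith

lemma contMDiff_hopfGroup_smul (γ : hopfGroup n s lam hlam) :
    ContMDiff 𝓘(ℂ, Cn n) 𝓘(ℂ, Cn n) ω (fun z : coneCompl n s => γ • z) := by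
  obtain ⟨m, -, hγ⟩ := exists_zpow_smul γ
  have := continuousConstSMul_hopfGroup (n := n) (s := s) (hlam := hlam)
  rw [ContMDiff.iff_comp_isImmersion (Manifold.IsImmersion.of_opens (coneCompl n s))]
  refine ⟨continuous_const_smul γ, ?_⟩
  have : (Subtype.val ∘ fun z : coneCompl n s => γ • z) = (fun w : Cn n => lam ^ m • w) ∘
    Subtype.val := funext hγ
  rw [this]
  exact (contDiff_const_smul _).contMDiff.comp contMDiff_subtype_val

end

noncomputable section

/-! ### The quotient manifold -/

variable {n s : ℕ} {lam : ℂ} {hlam : lam ≠ 0}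

lemma hopfProj_eq_iff {z w : coneCompl n s} :
    hopfProj n s lam hlam z = hopfProj n s lam hlam w ↔
      ∃ m : ℤ, (w : Cn n) = lam ^ m • (z : Cn n) := by
  rw [eq_comm]
  refine (Quotient.eq (r := MulAction.orbitRel (hopfGroup n s lam hlam) (coneCompl n s))).trans ?_
  rw [MulAction.orbitRel_apply]
  constructor
  · rintro ⟨γ, rfl⟩
    obtain ⟨m, -, hm⟩ := exists_zpow_smul γ
    exact ⟨m, hm z⟩
  · rintro ⟨m, hm⟩
    obtain ⟨γ, hγ⟩ := exists_smul_eq_zpow hlam m z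
    exact ⟨γ, Subtype.ext (hγ.trans hm.symm)⟩

lemma hopfProj_surjective : Function.Surjective (hopfProj n s lam hlam) := Quotient.mk_surjective

variable [IsCancelSMul (hopfGroup n s lam hlam) (coneCompl n s)]
  [ContinuousConstSMul (hopfGroup n s lam hlam) (coneCompl n s)]
  [ProperlyDiscontinuousSMul (hopfGroup n s lam hlam) (coneCompl n s)]

lemma isLocalHomeomorph_hopfProj : IsLocalHomeomorph (hopfProj n s lam hlam) :=
  isQuotientCoveringMap_quotientMk_of_properlyDiscontinuousSMul.isCoveringMap.isLocalHomeomorph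

/-- A chart of the quotient is a lift chart if it is a local section of the projection. -/
def IsLiftChart (e : OpenPartialHomeomorph (HopfQuot n s lam hlam) (Cn n)) : Prop :=
  ∀ y ∈ e.source, ∃ h : e y ∈ coneCompl n s, hopfProj n s lam hlam ⟨e y, h⟩ = y

/-- The lift chart given by the local inverse of the projection at `z`. -/
def liftChart (z : coneCompl n s) : OpenPartialHomeomorph (HopfQuot n s lam hlam) (Cn n) :=
  ((isLocalHomeomorph_hopfProj (hlam := hlam)).localInverseAt z).trans (chartAt (Cn n) z)

lemma isLiftChart_liftChart (z : coneCompl n s) :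
    IsLiftChart (liftChart (hlam := hlam) z) := fun _ hy =>
  ⟨((isLocalHomeomorph_hopfProj (hlam := hlam)).localInverseAt z _).2,
    (isLocalHomeomorph_hopfProj (hlam := hlam)).apply_localInverseAt_of_mem hy.1⟩

lemma mem_liftChart_source (z : coneCompl n s) :
    hopfProj n s lam hlam z ∈ (liftChart (hlam := hlam) z).source := by
  have h : (isLocalHomeomorph_hopfProj (hlam := hlam)).localInverseAt z
    (hopfProj n s lam hlam z) = z := by simp
  refine ⟨by simp, ?_⟩
  change (isLocalHomeomorph_hopfProj (hlam := hlam)).localInverseAt z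
    (hopfProj n s lam hlam z) ∈ (chartAt (Cn n) z).source
  rw [h]
  exact mem_chart_source _ z

lemma liftChart_apply_self (z : coneCompl n s) :
    liftChart (hlam := hlam) z (hopfProj n s lam hlam z) = z := by
  have h : (isLocalHomeomorph_hopfProj (hlam := hlam)).localInverseAt z
    (hopfProj n s lam hlam z) = z := by simp
  rw [liftChart, OpenPartialHomeomorph.coe_trans, Function.comp_apply, h]
  rfl

lemma isLiftChart_of_mem_atlas {e : OpenPartialHomeomorph (HopfQuot n s lam hlam) (Cn n)}
    (he : e ∈ atlas (Cn n) (HopfQuot n s lam hlam)) : IsLiftChart e := by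
  obtain ⟨q, rfl⟩ := he
  exact isLiftChart_liftChart _

lemma isLiftChart_chartAt (x : HopfQuot n s lam hlam) : IsLiftChart (chartAt (Cn n) x) :=
  isLiftChart_of_mem_atlas (chart_mem_atlas _ x)

variable {e e' : OpenPartialHomeomorph (HopfQuot n s lam hlam) (Cn n)}

/-- Two lift charts differ locally by an element of `G_λ`. -/
lemma IsLiftChart.eventually_eq_smul (he : IsLiftChart e) (he' : IsLiftChart e')
    {x : HopfQuot n s lam hlam} (hx : x ∈ e.source) (hx' : x ∈ e'.source) :
    ∃ m : ℤ, ∀ᶠ y in 𝓝 x, e' y = lam ^ m • e y := by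
  obtain ⟨h, hp⟩ := he x hx
  obtain ⟨h', hp'⟩ := he' x hx'
  obtain ⟨m, hm⟩ := hopfProj_eq_iff.1 (hp.trans hp'.symm)
  refine ⟨m, ?_⟩
  -- The values e' y and λ^m e y are two lifts of the same y. For y near x both lie in the sheet
  -- `φ.target`, on which the projection is injective, so they agree.
  set φ := (isLocalHomeomorph_hopfProj (n := n) (s := s) (hlam := hlam)).localInverseAt ⟨e' x, h'⟩
  have hU : IsOpen (Subtype.val '' φ.target : Set (Cn n)) :=
    (coneCompl n s).isOpen.isOpenMap_subtype_val _ φ.open_target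
  have hU' : e' x ∈ (Subtype.val '' φ.target : Set (Cn n)) :=
    ⟨⟨e' x, h'⟩, IsLocalHomeomorph.self_mem_localInverseAt_target _, rfl⟩
  have h1 := (e'.continuousAt hx').preimage_mem_nhds (hU.mem_nhds hU')
  have h2 : ∀ᶠ y in 𝓝 x, lam ^ m • e y ∈ (Subtype.val '' φ.target : Set (Cn n)) :=
    ((e.continuousAt hx).const_smul (lam ^ m)).preimage_mem_nhds
      (hU.mem_nhds (by
        rw [Pi.smul_apply, ← show e' x = lam ^ m • e x from hm]
        exact hU'))
  filter_upwards [h1, h2, e.open_source.mem_nhds hx, e'.open_source.mem_nhds hx']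
    with y hy1 hy2 hy hy'
  obtain ⟨a, ha, ha'⟩ := hy1
  obtain ⟨b, hb, hb'⟩ := hy2
  obtain ⟨k, hk⟩ := he y hy
  obtain ⟨k', hk'⟩ := he' y hy'
  have hab : a = b := by
    refine (isLocalHomeomorph_hopfProj (hlam := hlam)).injOn_localInverseAt_target ha hb ?_
    have hA : hopfProj n s lam hlam a = y := by
      rw [← hk']
      exact congrArg _ (Subtype.ext ha')
    have hB : hopfProj n s lam hlam b = y := by
      rw [← hk, eq_comm]
      exact hopfProj_eq_iff.2 ⟨m, hb'⟩
    rw [hA, hB]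
  rw [← ha', ← hb', hab]

/-! ### Smoothness of the quotient, for real and complex scalars at once -/

section Smooth

variable {𝕜 : Type*} [NontriviallyNormedField 𝕜] [NormedSpace 𝕜 (Cn n)] [SMulCommClass 𝕜 ℂ (Cn n)]
  {k : WithTop ℕ∞}

/-- Near each point the transition is multiplication by a fixed power of λ, hence smooth of every
class over any field whose scalars commute with the complex ones. -/
lemma IsLiftChart.contDiffOn_transition (he : IsLiftChart e) (he' : IsLiftChart e') :
    ContDiffOn 𝕜 k (e.symm.trans e') (e.symm.trans e').source := by
  intro p hp
  have hx : e.symm p ∈ e.source := e.map_target hp.1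
  obtain ⟨m, hm⟩ := he.eventually_eq_smul he' hx hp.2
  have h1 : ∀ᶠ q in 𝓝 p, (e.symm.trans e') q = lam ^ m • q := by
    filter_upwards [(e.symm.continuousAt hp.1).eventually hm, e.open_target.mem_nhds hp.1]
      with q hq hq'
    rw [e.right_inv hq'] at hq
    exact hq
  exact ((contDiff_const_smul (lam ^ m)).contDiffAt.congr_of_eventuallyEq h1).contDiffWithinAt

lemma IsLiftChart.transition_mem_contDiffGroupoid (he : IsLiftChart e) (he' : IsLiftChart e') :
    e.symm.trans e' ∈ contDiffGroupoid k 𝓘(𝕜, Cn n) := by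
  rw [contDiffGroupoid, mem_groupoid_of_pregroupoid]
  have h1 := he.contDiffOn_transition (𝕜 := 𝕜) (k := k) he'
  have h2 := he'.contDiffOn_transition (𝕜 := 𝕜) (k := k) he
  refine ⟨?_, ?_⟩
  · simpa [contDiffPregroupoid] using h1
  · simpa [contDiffPregroupoid] using h2

lemma isManifold_hopfQuot : IsManifold 𝓘(𝕜, Cn n) k (HopfQuot n s lam hlam) where
  compatible he he' :=
    (isLiftChart_of_mem_atlas he).transition_mem_contDiffGroupoid (isLiftChart_of_mem_atlas he')

lemma IsLiftChart.mem_maximalAtlas (he : IsLiftChart e) :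
    e ∈ IsManifold.maximalAtlas 𝓘(𝕜, Cn n) k (HopfQuot n s lam hlam) := by
  rw [IsManifold.mem_maximalAtlas_iff, mem_maximalAtlas_iff]
  exact fun e' he' =>
    ⟨he.transition_mem_contDiffGroupoid (isLiftChart_of_mem_atlas he'),
      (isLiftChart_of_mem_atlas he').transition_mem_contDiffGroupoid he⟩

/-- Near z the projection is the inverse of the lift chart at z, and lift charts belong to the
maximal atlas. -/
lemma isLocalDiffeomorph_hopfProj :
    IsLocalDiffeomorph 𝓘(𝕜, Cn n) 𝓘(𝕜, Cn n) k (hopfProj n s lam hlam) := by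
  intro z
  have := isManifold_hopfQuot (n := n) (s := s) (hlam := hlam) (𝕜 := 𝕜) (k := k)
  set φ := (isLocalHomeomorph_hopfProj (n := n) (s := s) (hlam := hlam)).localInverseAt z
  have he : liftChart (hlam := hlam) z ∈
    IsManifold.maximalAtlas 𝓘(𝕜, Cn n) k (HopfQuot n s lam hlam) :=
    (isLiftChart_liftChart z).mem_maximalAtlas
  set e := liftChart (hlam := hlam) z
  have hval : ContMDiff 𝓘(𝕜, Cn n) 𝓘(𝕜, Cn n) k (Subtype.val : coneCompl n s → Cn n) :=
    contMDiff_subtype_val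
  let Φ : PartialDiffeomorph 𝓘(𝕜, Cn n) 𝓘(𝕜, Cn n) (coneCompl n s) (HopfQuot n s lam hlam) k :=
    { toPartialEquiv := ((chartAt (Cn n) z).trans e.symm).toPartialEquiv
      open_source := ((chartAt (Cn n) z).trans e.symm).open_source
      open_target := ((chartAt (Cn n) z).trans e.symm).open_target
      contMDiffOn_toFun := (contMDiffOn_symm_of_mem_maximalAtlas he).comp
        (contMDiffOn_chart.mono fun y hy => hy.1) fun y hy => hy.2
      contMDiffOn_invFun := contMDiffOn_chart_symm.comp
        ((contMDiffOn_of_mem_maximalAtlas he).mono fun y hy => hy.1) fun y hy => hy.2 }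
  have hΦ : ∀ w ∈ Φ.source, hopfProj n s lam hlam w = Φ w := by
    intro w hw
    have h1 : (w : Cn n) ∈ e.target := hw.2
    obtain ⟨h2, h3⟩ := isLiftChart_liftChart z _ (e.map_target h1)
    refine Eq.trans ?_ h3
    exact congrArg _ (Subtype.ext (e.right_inv h1).symm)
  refine ⟨Φ, ⟨mem_chart_source _ z, ?_⟩, hΦ⟩
  have := e.map_source (mem_liftChart_source z)
  rwa [liftChart_apply_self] at this

end Smooth

end

noncomputable section

/-! ### The metric -/

variable {n s : ℕ} {lam : ℂ} {hlam : lam ≠ 0}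
  [IsCancelSMul (hopfGroup n s lam hlam) (coneCompl n s)]
  [ContinuousConstSMul (hopfGroup n s lam hlam) (coneCompl n s)]
  [ProperlyDiscontinuousSMul (hopfGroup n s lam hlam) (coneCompl n s)]

lemma exists_chartAt_eq_smul {x y : HopfQuot n s lam hlam} (hy : y ∈ (chartAt (Cn n) x).source) :
    ∃ m : ℤ, ∀ᶠ w in 𝓝 y, chartAt (Cn n) x w = lam ^ m • chartAt (Cn n) y w :=
  (isLiftChart_chartAt y).eventually_eq_smul (isLiftChart_chartAt x) (mem_chart_source _ y) hy

lemma chartAt_ne_zero {x y : HopfQuot n s lam hlam} (hy : y ∈ (chartAt (Cn n) x).source) :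
    chartAt (Cn n) x y ≠ 0 :=
  coneCompl_ne_zero (isLiftChart_chartAt x y hy).1

lemma hermQ_chartAt_ne_zero {x y : HopfQuot n s lam hlam} (hy : y ∈ (chartAt (Cn n) x).source) :
    hermQ n s (chartAt (Cn n) x y) ≠ 0 :=
  (mem_coneCompl_iff n s _).1 (isLiftChart_chartAt x y hy).1

/-- The same constant c governs the chart values, the derivative of the transition and (inverted)
that of the reverse transition. The later computations in the tangent bundle use only this. -/
lemma exists_transition_factor {x y : HopfQuot n s lam hlam}
    (hy : y ∈ (chartAt (Cn n) x).source) :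
    ∃ c : ℂ, c ≠ 0 ∧ (∀ᶠ w in 𝓝 y, chartAt (Cn n) x w = c • chartAt (Cn n) y w) ∧
      HasFDerivAt (chartAt (Cn n) x ∘ (chartAt (Cn n) y).symm)
        (c • ContinuousLinearMap.id ℝ (Cn n)) (chartAt (Cn n) y y) ∧
      HasFDerivAt (chartAt (Cn n) y ∘ (chartAt (Cn n) x).symm)
        (c⁻¹ • ContinuousLinearMap.id ℝ (Cn n)) (chartAt (Cn n) x y) := by
  obtain ⟨m, hm⟩ := exists_chartAt_eq_smul hy
  have hc : lam ^ m ≠ 0 := zpow_ne_zero m hlam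
  refine ⟨lam ^ m, hc, hm, ?_, ?_⟩
  · have hp : chartAt (Cn n) y y ∈ (chartAt (Cn n) y).target := mem_chart_target _ y
    have h1 : chartAt (Cn n) x ∘ (chartAt (Cn n) y).symm =ᶠ[𝓝 (chartAt (Cn n) y y)]
        fun q => lam ^ m • q := by
      have h2 := (chartAt (Cn n) y).symm.continuousAt hp
      rw [ContinuousAt, (chartAt (Cn n) y).left_inv (mem_chart_source _ y)] at h2
      filter_upwards [h2.eventually hm, (chartAt (Cn n) y).open_target.mem_nhds hp] with q hq hq'
      rw [(chartAt (Cn n) y).right_inv hq'] at hq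
      exact hq
    exact ((hasFDerivAt_id _).const_smul (lam ^ m)).congr_of_eventuallyEq h1
  · have hp : chartAt (Cn n) x y ∈ (chartAt (Cn n) x).target := (chartAt (Cn n) x).map_source hy
    have h1 : chartAt (Cn n) y ∘ (chartAt (Cn n) x).symm =ᶠ[𝓝 (chartAt (Cn n) x y)]
        fun q => (lam ^ m)⁻¹ • q := by
      have h2 := (chartAt (Cn n) x).symm.continuousAt hp
      rw [ContinuousAt, (chartAt (Cn n) x).left_inv hy] at h2
      filter_upwards [h2.eventually hm, (chartAt (Cn n) x).open_target.mem_nhds hp] with q hq hq'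
      rw [(chartAt (Cn n) x).right_inv hq'] at hq
      rw [eq_inv_smul_iff₀ hc]
      exact hq.symm
    exact ((hasFDerivAt_id _).const_smul (lam ^ m)⁻¹).congr_of_eventuallyEq h1

/-! ### The flat connection, read in lift charts -/

variable [IsManifold 𝓘(ℝ, Cn n) ∞ (HopfQuot n s lam hlam)]

/-- The coordinate change of the tangent bundle, from the preferred chart at `y` to the one at `x`,
is the multiplication by the factor `c` with `chartAt x = c • chartAt y` near `y`. -/
lemma tangentCoordChange_eq_smul {x y : HopfQuot n s lam hlam} {c : ℂ}
    (h : HasFDerivAt (chartAt (Cn n) x ∘ (chartAt (Cn n) y).symm)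
        (c • ContinuousLinearMap.id ℝ (Cn n)) (chartAt (Cn n) y y)) :
    tangentCoordChange 𝓘(ℝ, Cn n) y x y = c • ContinuousLinearMap.id ℝ (Cn n) := by
  rw [tangentCoordChange_def]
  simp only [mfld_simps, fderivWithin_univ]
  exact h.fderiv

/-- A vector field read in the preferred chart at `x`. -/
def coordRep (x : HopfQuot n s lam hlam)
    (Y : ∀ y : HopfQuot n s lam hlam, TangentSpace 𝓘(ℝ, Cn n) y) (q : Cn n) : Cn n :=
  tangentCoordChange 𝓘(ℝ, Cn n) ((chartAt (Cn n) x).symm q) x ((chartAt (Cn n) x).symm q)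
    (Y ((chartAt (Cn n) x).symm q))

lemma coordRep_self (x : HopfQuot n s lam hlam)
    (Y : ∀ y : HopfQuot n s lam hlam, TangentSpace 𝓘(ℝ, Cn n) y) :
    coordRep x Y (chartAt (Cn n) x x) = Y x := by
  rw [coordRep, (chartAt (Cn n) x).left_inv (mem_chart_source _ x)]
  exact tangentCoordChange_self (mem_extChartAt_source x)

lemma VFDiffAt.differentiableAt_coordRep {x : HopfQuot n s lam hlam}
    {Y : ∀ y : HopfQuot n s lam hlam, TangentSpace 𝓘(ℝ, Cn n) y} (h : VFDiffAt Y x) :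
    DifferentiableAt ℝ (coordRep x Y) (chartAt (Cn n) x x) := by
  have h1 := (mdifferentiableAt_section _ _).1 h
  have h2 := ((mdifferentiableAt_iff _ _).1 h1).2
  simp only [mfld_simps, differentiableWithinAt_univ, writtenInExtChartAt] at h2
  exact h2

/-- The flat connection of the quotient: vector fields are differentiated in lift charts. -/
def flatCov (Y : ∀ y : HopfQuot n s lam hlam, TangentSpace 𝓘(ℝ, Cn n) y)
    (x : HopfQuot n s lam hlam) :
    TangentSpace 𝓘(ℝ, Cn n) x →L[ℝ] TangentSpace 𝓘(ℝ, Cn n) x :=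
  (fderiv ℝ (coordRep x Y) (chartAt (Cn n) x x) : Cn n →L[ℝ] Cn n)

variable {x : HopfQuot n s lam hlam}

omit [IsManifold 𝓘(ℝ, Cn n) ∞ (HopfQuot n s lam hlam)] in
lemma hasMFDerivAt_of_comp_chartAt_symm {E' : Type*} [NormedAddCommGroup E'] [NormedSpace ℝ E']
    {F : HopfQuot n s lam hlam → E'} {F' : Cn n →L[ℝ] E'} (hc : ContinuousAt F x)
    (h : HasFDerivAt (F ∘ (chartAt (Cn n) x).symm) F' (chartAt (Cn n) x x)) :
    HasMFDerivAt 𝓘(ℝ, Cn n) 𝓘(ℝ, E') F x F' := by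
  refine ⟨hc, ?_⟩
  simp only [mfld_simps, writtenInExtChartAt]
  exact h.hasFDerivWithinAt

/-- Reading a field in the chart is linear over functions at each point, so both axioms reduce to
the sum and product rules in ℂⁿ. -/
lemma isCovariantDerivativeOn_flatCov (U : Set (HopfQuot n s lam hlam)) :
    IsCovariantDerivativeOn (Cn n) (flatCov (n := n) (s := s) (lam := lam) (hlam := hlam)) U where
  add {σ σ' x} hσ hσ' _ := by
    have h : coordRep x (σ + σ') = coordRep x σ + coordRep x σ' := by
      ext1 q
      exact map_add _ _ _
    change fderiv ℝ (coordRep x (σ + σ')) _ = _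
    rw [h]
    exact fderiv_add (VFDiffAt.differentiableAt_coordRep hσ) (VFDiffAt.differentiableAt_coordRep hσ')
  leibniz {σ g x} hσ hg _ := by
    have h : coordRep x (g • σ) = fun q => g ((chartAt (Cn n) x).symm q) • coordRep x σ q := by
      ext1 q
      exact (tangentCoordChange 𝓘(ℝ, Cn n) ((chartAt (Cn n) x).symm q) x
        ((chartAt (Cn n) x).symm q)).map_smul _ _
    change fderiv ℝ (coordRep x (g • σ)) _ = _
    have hg' : DifferentiableAt ℝ (g ∘ (chartAt (Cn n) x).symm) (chartAt (Cn n) x x) := by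
      have := ((mdifferentiableAt_iff _ _).1 hg).2
      simpa only [mfld_simps, differentiableWithinAt_univ, writtenInExtChartAt] using! this
    rw [h]
    have h1 := fderiv_fun_smul hg' (VFDiffAt.differentiableAt_coordRep hσ)
    refine h1.trans ?_
    rw [coordRep_self, Function.comp_apply,
      (chartAt (Cn n) x).left_inv (mem_chart_source _ x)]
    congr 2
    have h2 := (hasMFDerivAt_of_comp_chartAt_symm hg.continuousAt hg'.hasFDerivAt).mfderiv
    rw [mvfderiv, h2]
    rfl

/-- Both sides are multiplication by the transition factor c: the inverse chart has derivative c⁻¹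
in preferred coordinates. This identifies the pullback in the definition of the manifold bracket
with `coordRep`. -/
lemma mfderiv_chartAt_symm_inverse {q : Cn n} (hq : q ∈ (chartAt (Cn n) x).target)
    (v : TangentSpace 𝓘(ℝ, Cn n) ((chartAt (Cn n) x).symm q)) :
    (mfderiv 𝓘(ℝ, Cn n) 𝓘(ℝ, Cn n) (chartAt (Cn n) x).symm q).inverse v =
      tangentCoordChange 𝓘(ℝ, Cn n) ((chartAt (Cn n) x).symm q) x ((chartAt (Cn n) x).symm q) v := by
  set y := (chartAt (Cn n) x).symm q with hy
  have hys : y ∈ (chartAt (Cn n) x).source := (chartAt (Cn n) x).map_target hq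
  have hqy : chartAt (Cn n) x y = q := (chartAt (Cn n) x).right_inv hq
  obtain ⟨c, hc, -, h1, h2⟩ := exists_transition_factor hys
  have h3 : HasMFDerivAt 𝓘(ℝ, Cn n) 𝓘(ℝ, Cn n) (chartAt (Cn n) x).symm q
      (c⁻¹ • ContinuousLinearMap.id ℝ (Cn n)) := by
    refine ⟨(chartAt (Cn n) x).symm.continuousAt hq, ?_⟩
    rw [hqy] at h2
    simp only [mfld_simps, writtenInExtChartAt, ← hy]
    exact h2.hasFDerivWithinAt
  rw [h3.mfderiv, tangentCoordChange_eq_smul h1]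
  let e : Cn n ≃L[ℝ] Cn n := ContinuousLinearEquiv.equivOfInverse
    (c⁻¹ • ContinuousLinearMap.id ℝ (Cn n)) (c • ContinuousLinearMap.id ℝ (Cn n))
    (fun v => by simp [smul_smul, hc]) (fun v => by simp [smul_smul, hc])
  have he : (c⁻¹ • ContinuousLinearMap.id ℝ (Cn n)).inverse = c • ContinuousLinearMap.id ℝ (Cn n) :=
    ContinuousLinearMap.inverse_equiv e
  exact congrArg (fun A : Cn n →L[ℝ] Cn n => A _) he

lemma mpullback_chartAt_symm_eventuallyEq
    (Y : ∀ y : HopfQuot n s lam hlam, TangentSpace 𝓘(ℝ, Cn n) y) :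
    (VectorField.mpullbackWithin 𝓘(ℝ, Cn n) 𝓘(ℝ, Cn n) (extChartAt 𝓘(ℝ, Cn n) x).symm Y
      (Set.range 𝓘(ℝ, Cn n)) : Cn n → Cn n) =ᶠ[𝓝 (chartAt (Cn n) x x)] coordRep x Y := by
  filter_upwards [(chartAt (Cn n) x).open_target.mem_nhds (mem_chart_target _ x)] with q hq
  rw [coordRep, ← mfderiv_chartAt_symm_inverse hq, VectorField.mpullbackWithin_apply]
  simp only [mfld_simps, mfderivWithin_univ]
  rfl

/-- Turns vanishing torsion into the formula for the Lie bracket in ℂⁿ. No further derivative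
enters, since the chart at x has derivative the identity at its own centre. -/
lemma mlieBracket_eq_coordRep
    (X Y : ∀ y : HopfQuot n s lam hlam, TangentSpace 𝓘(ℝ, Cn n) y) :
    VectorField.mlieBracket 𝓘(ℝ, Cn n) X Y x =
      VectorField.lieBracket ℝ (coordRep x X) (coordRep x Y) (chartAt (Cn n) x x) := by
  rw [← VectorField.mlieBracketWithin_univ, VectorField.mlieBracketWithin_apply]
  have h1 : mfderiv 𝓘(ℝ, Cn n) 𝓘(ℝ, Cn n) (extChartAt 𝓘(ℝ, Cn n) x) x =
      ContinuousLinearMap.id ℝ (Cn n) := by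
    have h := mfderiv_chartAt_eq_tangentCoordChange (I := 𝓘(ℝ, Cn n)) (mem_chart_source (Cn n) x)
    simp only [mfld_simps]
    rw [h]
    ext1 v
    exact tangentCoordChange_self (mem_extChartAt_source x)
  rw [h1]
  have h2 : ((extChartAt 𝓘(ℝ, Cn n) x).symm ⁻¹' Set.univ ∩ Set.range 𝓘(ℝ, Cn n)) = Set.univ := by
    simp
  rw [h2]
  have h3 := ((mpullback_chartAt_symm_eventuallyEq (x := x) X).lieBracket_vectorField_eq
    (mpullback_chartAt_symm_eventuallyEq (x := x) Y) (𝕜 := ℝ))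
  refine Eq.trans ?_ h3
  have h4 : ∀ (V W : Cn n → Cn n) (p : Cn n), VectorField.lieBracketWithin ℝ V W Set.univ p =
      VectorField.lieBracket ℝ V W p := fun V W p => congrFun VectorField.lieBracketWithin_univ p
  exact (congrArg (fun A : Cn n →L[ℝ] Cn n => A _) ContinuousLinearMap.inverse_id).trans (h4 _ _ _)

/-- Coordinate changes are complex homotheties and so commute with i; after differentiation this is
∇J = 0. -/
lemma coordRep_tangentJ_eventuallyEq
    (Y : ∀ y : HopfQuot n s lam hlam, TangentSpace 𝓘(ℝ, Cn n) y) :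
    coordRep x (fun y => tangentJ (Y y)) =ᶠ[𝓝 (chartAt (Cn n) x x)]
      Complex.I • coordRep x Y := by
  filter_upwards [(chartAt (Cn n) x).open_target.mem_nhds (mem_chart_target _ x)] with q hq
  obtain ⟨c, -, -, h1, -⟩ := exists_transition_factor ((chartAt (Cn n) x).map_target hq)
  rw [Pi.smul_apply, coordRep, coordRep, tangentCoordChange_eq_smul h1]
  exact smul_comm c Complex.I (_ : Cn n)

lemma flatCov_tangentJ {Y : ∀ y : HopfQuot n s lam hlam, TangentSpace 𝓘(ℝ, Cn n) y}
    (hY : VFDiffAt Y x) (v : TangentSpace 𝓘(ℝ, Cn n) x) :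
    flatCov (fun y => tangentJ (Y y)) x v = tangentJ (flatCov Y x v) := by
  have h := (coordRep_tangentJ_eventuallyEq (x := x) Y).fderiv_eq (𝕜 := ℝ)
  rw [fderiv_const_smul hY.differentiableAt_coordRep] at h
  exact congrArg (fun A : Cn n →L[ℝ] Cn n => A v) h

end

/-! ### Conformally flat metrics on the quotient -/

noncomputable section

variable {n s : ℕ} {lam : ℂ} {hlam : lam ≠ 0}

lemma exists_hasFDerivAt_flatMetric (K : ℝ) {A B : Cn n → Cn n} {p : Cn n}
    (hA : DifferentiableAt ℝ A p) (hB : DifferentiableAt ℝ B p) :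
    ∃ L : Cn n →L[ℝ] ℝ, HasFDerivAt (fun q => K * flatMetric n s (A q) (B q)) L p ∧
      ∀ v, L v = K * (flatMetric n s (A p) (fderiv ℝ B p v) +
        flatMetric n s (fderiv ℝ A p v) (B p)) :=
  ⟨_, (((flatB n s).isBoundedBilinearMap.hasFDerivAt (A p, B p)).comp p
    (hA.hasFDerivAt.prodMk hB.hasFDerivAt)).const_mul K, fun _ => rfl⟩

variable
  [IsCancelSMul (hopfGroup n s lam hlam) (coneCompl n s)]
  [ContinuousConstSMul (hopfGroup n s lam hlam) (coneCompl n s)]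
  [ProperlyDiscontinuousSMul (hopfGroup n s lam hlam) (coneCompl n s)]
  [IsManifold 𝓘(ℝ, Cn n) ∞ (HopfQuot n s lam hlam)]
  {x : HopfQuot n s lam hlam}

/-- The field of bilinear forms `W • (flat metric)`. -/
def conformalFlat (W : HopfQuot n s lam hlam → ℝ) : BilinField n (HopfQuot n s lam hlam) :=
  fun x => (W x • flatB n s : Cn n →L[ℝ] Cn n →L[ℝ] ℝ)

/-- `W • (flat metric)` has the conformal factor `w` in the preferred chart at `x`. -/
def HasLocalFactor (W : HopfQuot n s lam hlam → ℝ) (x : HopfQuot n s lam hlam)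
    (w : HopfQuot n s lam hlam → ℝ) : Prop :=
  ∀ᶠ y in 𝓝 x, ∀ c : ℂ, chartAt (Cn n) x y = c • chartAt (Cn n) y y → W y = ‖c‖ ^ 2 * w y

/-- The |c|² in `HasLocalFactor` is what the flat metric gains when both arguments pass from the
chart at y to the chart at x. -/
lemma HasLocalFactor.eventually_conformalFlat {W w : HopfQuot n s lam hlam → ℝ}
    (h : HasLocalFactor W x w) : ∀ᶠ y in 𝓝 x, ∀ u v : TangentSpace 𝓘(ℝ, Cn n) y,
      conformalFlat W y u v = w y * flatMetric n s (tangentCoordChange 𝓘(ℝ, Cn n) y x y u)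
        (tangentCoordChange 𝓘(ℝ, Cn n) y x y v) := by
  filter_upwards [h, (chartAt (Cn n) x).open_source.mem_nhds (mem_chart_source _ x)] with y hy hys
  intro u v
  obtain ⟨c, hc, hm, h1, -⟩ := exists_transition_factor hys
  rw [tangentCoordChange_eq_smul h1]
  change W y * flatMetric n s u v = w y * flatMetric n s (c • (show Cn n from u)) (c • (show Cn n from v))
  rw [hy c hm.self_of_nhds, flatMetric_smul_smul]
  ring

lemma conformalFlat_hasMFDerivAt {W w : HopfQuot n s lam hlam → ℝ} {K : ℝ}
    (h : HasLocalFactor W x w) (hK : ∀ᶠ y in 𝓝 x, w y = K)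
    {Y Z : ∀ y : HopfQuot n s lam hlam, TangentSpace 𝓘(ℝ, Cn n) y} {L : Cn n →L[ℝ] ℝ}
    (hL : HasFDerivAt (fun q => K * flatMetric n s (coordRep x Y q) (coordRep x Z q)) L
      (chartAt (Cn n) x x)) :
    HasMFDerivAt 𝓘(ℝ, Cn n) 𝓘(ℝ, ℝ) (fun y => conformalFlat W y (Y y) (Z y)) x L := by
  set F : Cn n → ℝ := fun q => K * flatMetric n s (coordRep x Y q) (coordRep x Z q)
  have hev : (fun y => conformalFlat W y (Y y) (Z y)) =ᶠ[𝓝 x] F ∘ chartAt (Cn n) x := by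
    filter_upwards [h.eventually_conformalFlat, hK,
      (chartAt (Cn n) x).open_source.mem_nhds (mem_chart_source _ x)] with y hy hyK hys
    rw [hy, hyK, Function.comp_apply]
    simp only [F, coordRep]
    rw [(chartAt (Cn n) x).left_inv hys]
  have hd : HasMFDerivAt 𝓘(ℝ, Cn n) 𝓘(ℝ, ℝ) (F ∘ chartAt (Cn n) x) x L := by
    refine hasMFDerivAt_of_comp_chartAt_symm
      (hL.continuousAt.comp ((chartAt (Cn n) x).continuousAt (mem_chart_source _ x))) ?_
    refine hL.congr_of_eventuallyEq ?_
    filter_upwards [(chartAt (Cn n) x).open_target.mem_nhds (mem_chart_target _ x)] with q hq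
    rw [Function.comp_apply, Function.comp_apply, (chartAt (Cn n) x).right_inv hq]
  exact hd.congr_of_eventuallyEq hev

lemma conformalFlat_metric {W w : HopfQuot n s lam hlam → ℝ} {K : ℝ}
    (h : HasLocalFactor W x w) (hK : ∀ᶠ y in 𝓝 x, w y = K)
    {Y Z : ∀ y : HopfQuot n s lam hlam, TangentSpace 𝓘(ℝ, Cn n) y}
    (hY : VFDiffAt Y x) (hZ : VFDiffAt Z x) (v : TangentSpace 𝓘(ℝ, Cn n) x) :
    (show ℝ from mfderiv 𝓘(ℝ, Cn n) 𝓘(ℝ, ℝ) (fun y => conformalFlat W y (Y y) (Z y)) x v) =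
      conformalFlat W x (flatCov Y x v) (Z x) + conformalFlat W x (Y x) (flatCov Z x v) := by
  obtain ⟨L, hL, hLv⟩ := exists_hasFDerivAt_flatMetric (s := s) K hY.differentiableAt_coordRep
    hZ.differentiableAt_coordRep
  rw [coordRep_self, coordRep_self] at hLv
  have hW : W x = K := by
    have := h.self_of_nhds 1 (by rw [one_smul])
    rw [this, hK.self_of_nhds]
    simp
  have hd := conformalFlat_hasMFDerivAt h hK hL
  rw [hd.mfderiv]
  refine (hLv v).trans ?_
  change _ = W x * flatMetric n s (flatCov Y x v) (Z x) + W x * flatMetric n s (Y x) (flatCov Z x v)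
  rw [hW, ← mul_add, add_comm]
  rfl

/-- Where the factor is locally constant, the metric has constant coefficients in the chart. Metric
compatibility is then the product rule, and torsion-freeness is the flat bracket formula. -/
lemma isLeviCivitaOn_flatCov {W : HopfQuot n s lam hlam → ℝ} {U : Set (HopfQuot n s lam hlam)}
    (h : ∀ x ∈ U, ∃ w K, HasLocalFactor W x w ∧ ∀ᶠ y in 𝓝 x, w y = K) :
    IsLeviCivitaOn (conformalFlat W) flatCov U where
  isCovariantDerivativeOn := isCovariantDerivativeOn_flatCov U
  torsion_free X Y x _ _ _ := by
    rw [mlieBracket_eq_coordRep, VectorField.lieBracket, coordRep_self, coordRep_self]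
    rfl
  metric Y Z x hx hY hZ v := by
    obtain ⟨w, K, h1, h2⟩ := h x hx
    exact conformalFlat_metric h1 h2 hY hZ v

/-- In the trivialization centred at x the section is w times the constant form `flatB`, so its
smoothness is that of w. -/
lemma contMDiffAt_conformalFlat {W w : HopfQuot n s lam hlam → ℝ} (h : HasLocalFactor W x w)
    (hw : ContMDiffAt 𝓘(ℝ, Cn n) 𝓘(ℝ, ℝ) ∞ w x) :
    ContMDiffAt 𝓘(ℝ, Cn n) (𝓘(ℝ, Cn n).prod 𝓘(ℝ, Cn n →L[ℝ] Cn n →L[ℝ] ℝ)) ∞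
      (fun x => TotalSpace.mk' (Cn n →L[ℝ] Cn n →L[ℝ] ℝ)
        (E := fun x : HopfQuot n s lam hlam =>
          TangentSpace 𝓘(ℝ, Cn n) x →L[ℝ] TangentSpace 𝓘(ℝ, Cn n) x →L[ℝ] ℝ)
        x (conformalFlat W x)) x := by
  rw [contMDiffAt_section]
  have h1 : ContMDiffAt 𝓘(ℝ, Cn n) 𝓘(ℝ, Cn n →L[ℝ] Cn n →L[ℝ] ℝ) ∞
    (fun y => w y • flatB n s) x := hw.smul contMDiffAt_const
  refine h1.congr_of_eventuallyEq ?_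
  filter_upwards [h.eventually_conformalFlat,
    (chartAt (Cn n) x).open_source.mem_nhds (mem_chart_source _ x)] with y hy hys
  ext u v
  have hb : y ∈ (trivializationAt (Cn n)
    (TangentSpace 𝓘(ℝ, Cn n) : HopfQuot n s lam hlam → Type _) x).baseSet := hys
  have key : ∀ u : Cn n, tangentCoordChange 𝓘(ℝ, Cn n) y x y
      ((trivializationAt (Cn n) (TangentSpace 𝓘(ℝ, Cn n)) x).symm y u) = u := fun u =>
    congrArg Prod.snd ((trivializationAt (Cn n)
      (TangentSpace 𝓘(ℝ, Cn n) : HopfQuot n s lam hlam → Type _) x).apply_mk_symm hb u)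
  have h2 := inCoordinates_apply_eq₂ (F₃ := ℝ) (E₃ := Bundle.Trivial (HopfQuot n s lam hlam) ℝ)
    (ϕ := conformalFlat W y) (v := u) (w := v) hb hb (by simp)
  refine h2.trans ?_
  refine (congrArg (fun A : ℝ →ₗ[ℝ] ℝ => A _)
    (Bundle.Trivial.linearMapAt_trivialization ℝ (HopfQuot n s lam hlam) ℝ y)).trans ?_
  refine (hy _ _).trans ?_
  rw [key, key]
  rfl

lemma isIndefiniteHermitianOn_conformalFlat [IsManifold 𝓘(ℂ, Cn n) ω (HopfQuot n s lam hlam)]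
    (hs : 0 < s) (hsn : s < n) {W : HopfQuot n s lam hlam → ℝ} {U : Set (HopfQuot n s lam hlam)}
    (hpos : ∀ x ∈ U, 0 < W x)
    (h : ∀ x ∈ U, ∃ w, HasLocalFactor W x w ∧ ContMDiffAt 𝓘(ℝ, Cn n) 𝓘(ℝ, ℝ) ∞ w x) :
    IsIndefiniteHermitianOn (conformalFlat W) (2 * s) U where
  index_pos := by omega
  index_lt := by omega
  smooth x hx := by
    obtain ⟨w, h1, h2⟩ := h x hx
    exact (contMDiffAt_conformalFlat h1 h2).contMDiffWithinAt
  symm x _ u v := congrArg (W x * ·) (flatMetric_comm n s u v)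
  nondegenerate x hx u hu := flatMetric_nondegenerate n s u fun v =>
    (mul_eq_zero.1 (hu v : W x * flatMetric n s u v = 0)).resolve_left (hpos x hx).ne'
  index_eq x hx := sigNeg_flatMetric hsn.le (hpos x hx) _ fun _ => rfl
  hermitian x _ u v := congrArg (W x * ·) (by
    change flatMetric n s (Complex.I • (show Cn n from u)) (Complex.I • (show Cn n from v)) = _
    rw [flatMetric_smul_smul, Complex.norm_I, one_pow, one_mul]
    rfl)

/-- The metric `|z|_{s,n}^{-2} (flat metric)` on the quotient. -/
def hopfMetric : BilinField n (HopfQuot n s lam hlam) :=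
  conformalFlat fun x => |hermQ n s (chartAt (Cn n) x x)|⁻¹

-- The degrees cancel: |Q(cz)|⁻¹ |c|² = |Q(z)|⁻¹. This is why the metric descends.
omit [IsManifold 𝓘(ℝ, Cn n) ∞ (HopfQuot n s lam hlam)] in
lemma hasLocalFactor_hopf (x : HopfQuot n s lam hlam) :
    HasLocalFactor (fun y => |hermQ n s (chartAt (Cn n) y y)|⁻¹) x
      fun y => |hermQ n s (chartAt (Cn n) x y)|⁻¹ := by
  filter_upwards [(chartAt (Cn n) x).open_source.mem_nhds (mem_chart_source _ x)] with y hy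
  intro c hc
  have h0 := chartAt_ne_zero hy
  rw [hc] at h0 ⊢
  have hc0 : ‖c‖ ≠ 0 := norm_ne_zero_iff.2 (left_ne_zero_of_smul h0)
  rw [hermQ_smul, abs_mul, abs_of_nonneg (sq_nonneg ‖c‖), mul_inv, ← mul_assoc,
    mul_inv_cancel₀ (pow_ne_zero 2 hc0), one_mul]

omit [IsManifold 𝓘(ℝ, Cn n) ∞ (HopfQuot n s lam hlam)] in
lemma HasLocalFactor.mul {W w : HopfQuot n s lam hlam → ℝ} (h : HasLocalFactor W x w)
    (a : HopfQuot n s lam hlam → ℝ) :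
    HasLocalFactor (fun y => a y * W y) x fun y => a y * w y := by
  filter_upwards [h] with y hy
  intro c hc
  rw [hy c hc]
  ring

lemma contMDiffOn_comp_chartAt {f : ℝ → ℝ} (hf : ∀ t ≠ 0, ContDiffAt ℝ ∞ f t)
    (x : HopfQuot n s lam hlam) :
    ContMDiffOn 𝓘(ℝ, Cn n) 𝓘(ℝ, ℝ) ∞ (fun y => f (hermQ n s (chartAt (Cn n) x y)))
      (chartAt (Cn n) x).source := by
  intro y hy
  have h1 : ContMDiffWithinAt 𝓘(ℝ, Cn n) 𝓘(ℝ, Cn n) ∞ (chartAt (Cn n) x)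
    (chartAt (Cn n) x).source y := contMDiffOn_chart y hy
  have h2 : ContDiffAt ℝ ∞ (fun q => f (hermQ n s q)) (chartAt (Cn n) x y) :=
    (hf _ (hermQ_chartAt_ne_zero hy)).comp _ (contDiff_hermQ n s).contDiffAt
  exact h2.contMDiffAt.comp_contMDiffWithinAt y h1

lemma isIndefiniteLCK_hopfMetric [IsManifold 𝓘(ℂ, Cn n) ω (HopfQuot n s lam hlam)]
    (hs : 0 < s) (hsn : s < n) :
    IsIndefiniteLCK (hopfMetric (n := n) (s := s) (hlam := hlam)) (2 * s) := by
  have hpos : ∀ x : HopfQuot n s lam hlam, 0 < |hermQ n s (chartAt (Cn n) x x)|⁻¹ := fun x =>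
    inv_pos.2 (abs_pos.2 (hermQ_chartAt_ne_zero (mem_chart_source _ x)))
  refine ⟨isIndefiniteHermitianOn_conformalFlat hs hsn (fun x _ => hpos x) fun x _ =>
    ⟨_, hasLocalFactor_hopf x, ?_⟩, fun x₀ => ?_⟩
  · exact (contMDiffOn_comp_chartAt (f := fun t => |t|⁻¹)
      (fun t ht => (contDiffAt_abs ht).inv (abs_ne_zero.2 ht)) x).contMDiffAt
      (chart_source_mem_nhds _ x)
  -- `Real.log` ignores the sign of its argument, so e^{-f} = |Q| on both sides of the null cone.
  · set f : HopfQuot n s lam hlam → ℝ := fun y => -Real.log (hermQ n s (chartAt (Cn n) x₀ y))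
    -- In the chart at x the rescaled metric has factor |Q(cz)| / |Q(z)| = |c|², a constant near x.
    have hconst : ∀ x ∈ (chartAt (Cn n) x₀).source, ∃ K : ℝ, ∀ᶠ y in 𝓝 x,
        Real.exp (-f y) * |hermQ n s (chartAt (Cn n) x y)|⁻¹ = K := by
      intro x hx
      obtain ⟨c, -, hcx, -⟩ := exists_transition_factor hx
      refine ⟨‖c‖ ^ 2, ?_⟩
      filter_upwards [hcx, (chartAt (Cn n) x₀).open_source.mem_nhds hx,
        chart_source_mem_nhds (Cn n) x] with y hy hys hys'
      have h1 := hermQ_chartAt_ne_zero hys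
      have h2 := abs_ne_zero.2 (hermQ_chartAt_ne_zero hys')
      simp only [f, neg_neg]
      rw [Real.exp_log_eq_abs h1, hy, hermQ_smul, abs_mul, abs_of_nonneg (sq_nonneg _),
        mul_assoc, mul_inv_cancel₀ h2, mul_one]
    have heq : (fun y => Real.exp (-f y) • hopfMetric (n := n) (s := s) (hlam := hlam) y) =
        conformalFlat fun y => Real.exp (-f y) * |hermQ n s (chartAt (Cn n) y y)|⁻¹ := by
      ext1 y
      exact smul_smul (Real.exp (-f y)) (|hermQ n s (chartAt (Cn n) y y)|⁻¹) (flatB n s)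
    have hfac : ∀ x : HopfQuot n s lam hlam, HasLocalFactor
        (fun y => Real.exp (-f y) * |hermQ n s (chartAt (Cn n) y y)|⁻¹) x
        fun y => Real.exp (-f y) * |hermQ n s (chartAt (Cn n) x y)|⁻¹ := fun x =>
      (hasLocalFactor_hopf x).mul _
    refine ⟨(chartAt (Cn n) x₀).source, (chartAt (Cn n) x₀).open_source, mem_chart_source _ x₀,
      f, ?_, ?_, flatCov, ?_, ?_⟩
    · exact contMDiffOn_comp_chartAt (f := fun t => -Real.log t)
        (fun t ht => (Real.contDiffAt_log.2 ht).neg) x₀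
    · rw [heq]
      refine isIndefiniteHermitianOn_conformalFlat hs hsn
        (fun x _ => mul_pos (Real.exp_pos _) (hpos x)) fun x hx => ⟨_, hfac x, ?_⟩
      obtain ⟨K, hK⟩ := hconst x hx
      exact contMDiffAt_const.congr_of_eventuallyEq hK
    · rw [heq]
      refine isLeviCivitaOn_flatCov fun x hx => ?_
      obtain ⟨K, hK⟩ := hconst x hx
      exact ⟨_, K, hfac x, hK⟩
    · exact fun Y x _ hY v => flatCov_tangentJ hY v

-- The preferred chart at the image of z may have been built from another point of the orbit, so the
-- chart after the projection is multiplication by a power of λ near z rather than the identity.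
omit [IsManifold 𝓘(ℝ, Cn n) ∞ (HopfQuot n s lam hlam)] in
lemma exists_mfderiv_hopfProj (z : coneCompl n s) :
    ∃ c : ℂ, chartAt (Cn n) (hopfProj n s lam hlam z) (hopfProj n s lam hlam z) =
        c • (z : Cn n) ∧
      HasMFDerivAt 𝓘(ℝ, Cn n) 𝓘(ℝ, Cn n) (hopfProj n s lam hlam) z
        (c • ContinuousLinearMap.id ℝ (Cn n)) := by
  obtain ⟨m, hm⟩ := (isLiftChart_liftChart z).eventually_eq_smul
    (isLiftChart_chartAt (hopfProj n s lam hlam z)) (mem_liftChart_source z) (mem_chart_source _ _)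
  have hc : ContinuousAt (hopfProj n s lam hlam) z :=
    (isLocalHomeomorph_hopfProj (hlam := hlam)).continuous.continuousAt
  refine ⟨lam ^ m, by rw [hm.self_of_nhds, liftChart_apply_self], hc, ?_⟩
  set φ := (isLocalHomeomorph_hopfProj (n := n) (s := s) (hlam := hlam)).localInverseAt z with hφ
  have h1 : ∀ᶠ w in 𝓝 z, chartAt (Cn n) (hopfProj n s lam hlam z) (hopfProj n s lam hlam w) =
      lam ^ m • (w : Cn n) := by
    filter_upwards [hc.eventually hm, φ.open_target.mem_nhds
      (IsLocalHomeomorph.self_mem_localInverseAt_target _)] with w hw hw'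
    have h2 : φ (hopfProj n s lam hlam w) = w := by
      have := φ.right_inv hw'
      rwa [hφ, IsLocalHomeomorph.localInverseAt_symm] at this
    rw [hw]
    exact congrArg (fun y : coneCompl n s => lam ^ m • (y : Cn n)) h2
  simp only [mfld_simps, writtenInExtChartAt]
  refine HasFDerivAt.hasFDerivWithinAt ?_
  refine ((hasFDerivAt_id _).const_smul (lam ^ m)).congr_of_eventuallyEq ?_
  have h3 := (chartAt (Cn n) z).symm.continuousAt (mem_chart_target (Cn n) z)
  rw [ContinuousAt, (chartAt (Cn n) z).left_inv (mem_chart_source _ z)] at h3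
  filter_upwards [h3.eventually h1, chart_target_mem_nhds _ z] with q hq hq'
  refine hq.trans (congrArg (lam ^ m • ·) ?_)
  exact (chartAt (Cn n) z).right_inv hq'

omit [IsManifold 𝓘(ℝ, Cn n) ∞ (HopfQuot n s lam hlam)] in
lemma hopfMetric_mfderiv (z : coneCompl n s) (u v : Cn n) :
    hopfMetric (hopfProj n s lam hlam z)
      (mfderiv 𝓘(ℝ, Cn n) 𝓘(ℝ, Cn n) (hopfProj n s lam hlam) z u)
      (mfderiv 𝓘(ℝ, Cn n) 𝓘(ℝ, Cn n) (hopfProj n s lam hlam) z v) =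
    (pseudoNorm n s z ^ 2)⁻¹ * flatMetric n s u v := by
  obtain ⟨c, hc, h⟩ := exists_mfderiv_hopfProj (hlam := hlam) z
  rw [h.mfderiv, pseudoNorm_sq]
  change |hermQ n s (chartAt (Cn n) (hopfProj n s lam hlam z) (hopfProj n s lam hlam z))|⁻¹ *
    flatMetric n s (c • u) (c • v) = _
  have h0 : c • (z : Cn n) ≠ 0 := hc ▸ chartAt_ne_zero (mem_chart_source _ _)
  have hc0 : ‖c‖ ≠ 0 := norm_ne_zero_iff.2 (left_ne_zero_of_smul h0)
  rw [hc, hermQ_smul, flatMetric_smul_smul, abs_mul, abs_of_nonneg (sq_nonneg _)]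
  field_simp

end

noncomputable section

/-! ### Level sets of homogeneous functions -/

/-- `N` is continuous and positively homogeneous, and it is smooth where it is positive. -/
structure IsConeGauge {V : Type*} [NormedAddCommGroup V] [NormedSpace ℝ V] (N : V → ℝ) : Prop where
  continuous : Continuous N
  smul : ∀ t : ℝ, 0 < t → ∀ x, N (t • x) = t * N x
  contDiffAt : ∀ x, 0 < N x → ContDiffAt ℝ ∞ N x

section Level

variable {V : Type*} [NormedAddCommGroup V] [NormedSpace ℝ V] {k : ℕ} {N : V → ℝ}

lemma IsConeGauge.ne_zero (hN : IsConeGauge N) {x : V} (hx : N x ≠ 0) : x ≠ 0 := by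
  rintro rfl
  have := hN.smul 2 two_pos 0
  rw [smul_zero] at this
  exact hx (by linarith)

/-- Places x at height 1 on the last axis, so that a radial chart centred at x sees it with positive
height. -/
lemma exists_equiv_apply_eq (hk : Module.finrank ℝ V = k + 1) {x : V} (hx : x ≠ 0) :
    ∃ Φ : V ≃L[ℝ] EuclideanSpace ℝ (Fin k) × ℝ, Φ x = (0, 1) := by
  have : FiniteDimensional ℝ V := Module.finite_of_finrank_eq_succ hk
  have e : V ≃L[ℝ] EuclideanSpace ℝ (Fin k) × ℝ :=
    ContinuousLinearEquiv.ofFinrankEq (by simp [hk])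
  obtain ⟨A, hA⟩ := SeparatingDual.exists_continuousLinearEquiv_apply_eq (R := ℝ)
    (x := e x) (y := ((0, 1) : EuclideanSpace ℝ (Fin k) × ℝ)) (by simpa using hx) (by simp)
  exact ⟨e.trans A, hA⟩

/-- The radial projection to the hyperplane at height `1`, together with `N - 1`. -/
def sliceChart (hN : IsConeGauge N) (Φ : V ≃L[ℝ] EuclideanSpace ℝ (Fin k) × ℝ) :
    OpenPartialHomeomorph V (EuclideanSpace ℝ (Fin k) × ℝ) where
  toFun y := ((Φ y).2⁻¹ • (Φ y).1, N y - 1)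
  -- The point of the ray through (q.1, 1) at which N takes the value 1 + q.2.
  invFun q := ((1 + q.2) * (N (Φ.symm (q.1, 1)))⁻¹) • Φ.symm (q.1, 1)
  source := {y | 0 < (Φ y).2 ∧ 0 < N y}
  target := {q | 0 < N (Φ.symm (q.1, 1)) ∧ 0 < 1 + q.2}
  map_source' y hy := by
    have h : Φ.symm ((Φ y).2⁻¹ • (Φ y).1, 1) = (Φ y).2⁻¹ • y := by
      rw [ContinuousLinearEquiv.symm_apply_eq, map_smul]
      ext1 <;> simp [hy.1.ne']
    simp only [Set.mem_ofPred_eq, h, hN.smul _ (inv_pos.2 hy.1), add_sub_cancel]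
    exact ⟨mul_pos (inv_pos.2 hy.1) hy.2, hy.2⟩
  map_target' q hq := by
    have hc : 0 < (1 + q.2) * (N (Φ.symm (q.1, 1)))⁻¹ := mul_pos hq.2 (inv_pos.2 hq.1)
    simp only [Set.mem_ofPred_eq, map_smul, ContinuousLinearEquiv.apply_symm_apply, hN.smul _ hc]
    exact ⟨by simpa using hc, mul_pos hc hq.1⟩
  left_inv' y hy := by
    have h : Φ.symm ((Φ y).2⁻¹ • (Φ y).1, 1) = (Φ y).2⁻¹ • y := by
      rw [ContinuousLinearEquiv.symm_apply_eq, map_smul]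
      ext1 <;> simp [hy.1.ne']
    have h1 := hy.1.ne'
    have h2 := hy.2.ne'
    simp only [h, hN.smul _ (inv_pos.2 hy.1), add_sub_cancel, smul_smul]
    rw [show N y * ((Φ y).2⁻¹ * N y)⁻¹ * (Φ y).2⁻¹ = 1 by field_simp, one_smul]
  right_inv' q hq := by
    have hc : 0 < (1 + q.2) * (N (Φ.symm (q.1, 1)))⁻¹ := mul_pos hq.2 (inv_pos.2 hq.1)
    have h1 := hq.1.ne'
    simp only [map_smul, ContinuousLinearEquiv.apply_symm_apply, hN.smul _ hc]
    ext1
    · simp only [Prod.smul_mk, smul_smul, smul_eq_mul, mul_one, inv_mul_cancel₀ hc.ne', one_smul]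
    · simp only
      field_simp
      ring
  open_source := by
    have h1 : Continuous fun y => (Φ y).2 := by fun_prop
    exact (isOpen_lt continuous_const h1).inter (isOpen_lt continuous_const hN.continuous)
  open_target := by
    have h1 : Continuous fun q : EuclideanSpace ℝ (Fin k) × ℝ => N (Φ.symm (q.1, 1)) :=
      hN.continuous.comp (by fun_prop)
    have h2 : Continuous fun q : EuclideanSpace ℝ (Fin k) × ℝ => 1 + q.2 := by fun_prop
    exact (isOpen_lt continuous_const h1).inter (isOpen_lt continuous_const h2)
  continuousOn_toFun y hy := by
    have h1 : ContinuousAt (fun y => Φ y) y := by fun_prop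
    exact (((h1.snd.inv₀ hy.1.ne').smul h1.fst).prodMk
      (hN.continuous.continuousAt.sub continuousAt_const)).continuousWithinAt
  continuousOn_invFun q hq := by
    have h1 : ContinuousAt (fun q : EuclideanSpace ℝ (Fin k) × ℝ => Φ.symm (q.1, 1)) q := by
      fun_prop
    have h2 : ContinuousAt (fun q : EuclideanSpace ℝ (Fin k) × ℝ => N (Φ.symm (q.1, 1))) q :=
      hN.continuous.continuousAt.comp h1
    exact (((continuousAt_const.add continuousAt_snd).mul
      (h2.inv₀ hq.1.ne')).smul h1).continuousWithinAt

lemma contDiffOn_sliceChart (hN : IsConeGauge N) (Φ : V ≃L[ℝ] EuclideanSpace ℝ (Fin k) × ℝ) :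
    ContDiffOn ℝ ∞ (sliceChart hN Φ) (sliceChart hN Φ).source := by
  rintro y ⟨hy1, hy2⟩
  refine ContDiffAt.contDiffWithinAt ?_
  have h1 : ContDiffAt ℝ ∞ (fun y => Φ y) y := Φ.contDiff.contDiffAt
  exact ((h1.snd.inv hy1.ne').smul h1.fst).prodMk ((hN.contDiffAt y hy2).sub contDiffAt_const)

lemma contDiffOn_sliceChart_symm (hN : IsConeGauge N)
    (Φ : V ≃L[ℝ] EuclideanSpace ℝ (Fin k) × ℝ) :
    ContDiffOn ℝ ∞ (sliceChart hN Φ).symm (sliceChart hN Φ).target := by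
  rintro q ⟨hq1, -⟩
  refine ContDiffAt.contDiffWithinAt ?_
  have h1 : ContDiffAt ℝ ∞
      (fun q : EuclideanSpace ℝ (Fin k) × ℝ => Φ.symm (q.1, 1)) q :=
    Φ.symm.contDiff.contDiffAt.comp q (contDiffAt_fst.prodMk contDiffAt_const)
  have h2 : ContDiffAt ℝ ∞ (fun q : EuclideanSpace ℝ (Fin k) × ℝ => N (Φ.symm (q.1, 1))) q :=
    (hN.contDiffAt _ hq1).comp q h1
  exact ((contDiffAt_const.add contDiffAt_snd).mul (h2.inv hq1.ne')).smul h1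

/-- The point of the level set `N = 1` on the ray through `p`. -/
def levelPoint (hN : IsConeGauge N) (x₀ : {x | N x = 1}) (p : V) : {x | N x = 1} :=
  open Classical in if h : 0 < N p then ⟨(N p)⁻¹ • p, by
    change N _ = 1
    rw [hN.smul _ (inv_pos.2 h), inv_mul_cancel₀ h.ne']⟩ else x₀

lemma coe_levelPoint (hN : IsConeGauge N) (x₀ : {x | N x = 1}) {p : V} (hp : 0 < N p) :
    (levelPoint hN x₀ p : V) = (N p)⁻¹ • p := by
  rw [levelPoint, dif_pos hp]

/-- The radial chart of the level set `N = 1`. -/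
def levelChart (hN : IsConeGauge N) (x₀ : {x | N x = 1})
    (Φ : V ≃L[ℝ] EuclideanSpace ℝ (Fin k) × ℝ) :
    OpenPartialHomeomorph {x | N x = 1} (EuclideanSpace ℝ (Fin k)) where
  toFun y := (Φ y).2⁻¹ • (Φ y).1
  invFun h := levelPoint hN x₀ (Φ.symm (h, 1))
  source := {y | 0 < (Φ y).2}
  target := {h | 0 < N (Φ.symm (h, 1))}
  map_source' y hy := by
    have h : Φ.symm ((Φ y).2⁻¹ • (Φ y).1, 1) = (Φ y).2⁻¹ • (y : V) := by
      rw [ContinuousLinearEquiv.symm_apply_eq, map_smul]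
      ext1 <;> simp [(show 0 < (Φ y).2 from hy).ne']
    have hy1 : N y = 1 := y.2
    simp only [Set.mem_ofPred_eq, h, hN.smul _ (inv_pos.2 hy), hy1]
    simpa using hy
  map_target' h hh := by
    have hh' : 0 < N (Φ.symm (h, 1)) := hh
    simp only [Set.mem_ofPred_eq, coe_levelPoint hN x₀ hh, map_smul,
      ContinuousLinearEquiv.apply_symm_apply]
    simpa using hh
  left_inv' y hy := by
    have hy' : 0 < (Φ y).2 := hy
    have h : Φ.symm ((Φ y).2⁻¹ • (Φ y).1, 1) = (Φ y).2⁻¹ • (y : V) := by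
      rw [ContinuousLinearEquiv.symm_apply_eq, map_smul]
      ext1 <;> simp [hy'.ne']
    have hy1 : N y = 1 := y.2
    have hN1 : N ((Φ y).2⁻¹ • (y : V)) = (Φ y).2⁻¹ := by
      rw [hN.smul _ (inv_pos.2 hy'), hy1, mul_one]
    apply Subtype.ext
    rw [h, coe_levelPoint hN x₀ (by rw [hN1]; exact inv_pos.2 hy'), hN1, smul_smul, inv_inv,
      mul_inv_cancel₀ hy'.ne', one_smul]
  right_inv' h hh := by
    have hh' : 0 < N (Φ.symm (h, 1)) := hh
    simp only [coe_levelPoint hN x₀ hh', map_smul, ContinuousLinearEquiv.apply_symm_apply,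
      Prod.smul_mk, smul_smul, smul_eq_mul, mul_one, inv_inv, mul_inv_cancel₀ hh'.ne', one_smul]
  open_source := by
    have h1 : Continuous fun y : {x | N x = 1} => (Φ y).2 := by fun_prop
    exact isOpen_lt continuous_const h1
  open_target := by
    have h1 : Continuous fun h : EuclideanSpace ℝ (Fin k) => N (Φ.symm (h, 1)) :=
      hN.continuous.comp (by fun_prop)
    exact isOpen_lt continuous_const h1
  continuousOn_toFun y hy := by
    have hy' : 0 < (Φ y).2 := hy
    have h1 : ContinuousAt (fun y : {x | N x = 1} => Φ y) y := by fun_prop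
    exact ((h1.snd.inv₀ hy'.ne').smul h1.fst).continuousWithinAt
  continuousOn_invFun := by
    rw [Topology.IsInducing.subtypeVal.continuousOn_iff]
    have h1 : ContinuousOn (fun h => (N (Φ.symm (h, 1)))⁻¹ • Φ.symm (h, 1))
        {h : EuclideanSpace ℝ (Fin k) | 0 < N (Φ.symm (h, 1))} := by
      intro h hh
      have hh' : 0 < N (Φ.symm (h, 1)) := hh
      have h1 : ContinuousAt (fun h : EuclideanSpace ℝ (Fin k) => Φ.symm (h, 1)) h := by fun_prop
      have h2 : ContinuousAt (fun h : EuclideanSpace ℝ (Fin k) => N (Φ.symm (h, 1))) h :=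
        hN.continuous.continuousAt.comp h1
      exact ((h2.inv₀ hh'.ne').smul h1).continuousWithinAt
    exact h1.congr fun h hh => coe_levelPoint hN x₀ hh

lemma contDiffOn_levelChart_transition (hN : IsConeGauge N) (x₀ x₁ : {x | N x = 1})
    (Φ Ψ : V ≃L[ℝ] EuclideanSpace ℝ (Fin k) × ℝ) :
    ContDiffOn ℝ ∞ ((levelChart hN x₀ Φ).symm.trans (levelChart hN x₁ Ψ))
      ((levelChart hN x₀ Φ).symm.trans (levelChart hN x₁ Ψ)).source := by
  intro h hh
  have h0 : 0 < N (Φ.symm (h, 1)) := hh.1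
  have h1 : ContDiffAt ℝ ∞ (fun h : EuclideanSpace ℝ (Fin k) => Φ.symm (h, 1)) h :=
    Φ.symm.contDiff.contDiffAt.comp h (contDiffAt_id.prodMk contDiffAt_const)
  have h2 : ContDiffAt ℝ ∞ (fun h : EuclideanSpace ℝ (Fin k) =>
      (N (Φ.symm (h, 1)))⁻¹ • Φ.symm (h, 1)) h :=
    (((hN.contDiffAt _ h0).comp h h1).inv h0.ne').smul h1
  have h3 : ContDiffAt ℝ ∞ (fun h : EuclideanSpace ℝ (Fin k) =>
      Ψ ((N (Φ.symm (h, 1)))⁻¹ • Φ.symm (h, 1))) h := Ψ.contDiff.contDiffAt.comp h h2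
  have h4 : 0 < (Ψ (levelPoint hN x₀ (Φ.symm (h, 1)))).2 := hh.2
  rw [coe_levelPoint hN x₀ h0] at h4
  refine ContDiffWithinAt.congr_of_mem ((h3.snd.inv h4.ne').smul h3.fst).contDiffWithinAt
    (fun q hq => ?_) hh
  change (Ψ (levelPoint hN x₀ (Φ.symm (q, 1)))).2⁻¹ • (Ψ (levelPoint hN x₀ (Φ.symm (q, 1)))).1 = _
  rw [coe_levelPoint hN x₀ hq.1]
  rfl

/-- The charted space structure of the level set `N = 1` given by radial charts. -/
@[reducible] def levelChartedSpace (hN : IsConeGauge N)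
    (Φ : {x | N x = 1} → (V ≃L[ℝ] EuclideanSpace ℝ (Fin k) × ℝ)) (hΦ : ∀ x, Φ x x = (0, 1)) :
    ChartedSpace (EuclideanSpace ℝ (Fin k)) {x | N x = 1} where
  atlas := Set.range fun x => levelChart hN x (Φ x)
  chartAt x := levelChart hN x (Φ x)
  mem_chart_source x := by
    change 0 < (Φ x x).2
    simp [hΦ]
  chart_mem_atlas x := ⟨x, rfl⟩

lemma isManifold_level (hN : IsConeGauge N)
    (Φ : {x | N x = 1} → (V ≃L[ℝ] EuclideanSpace ℝ (Fin k) × ℝ)) (hΦ : ∀ x, Φ x x = (0, 1)) :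
    letI := levelChartedSpace hN Φ hΦ
    IsManifold (𝓡 k) ∞ {x | N x = 1} := by
  let _ := levelChartedSpace hN Φ hΦ
  refine isManifold_of_contDiffOn _ _ _ ?_
  rintro _ _ ⟨x, rfl⟩ ⟨y, rfl⟩
  simpa using contDiffOn_levelChart_transition hN x y (Φ x) (Φ y)

/-- The slice chart flattens the level set to height 0 and restricts there to the radial chart, so
in these coordinates the inclusion is h ↦ (h, 0). -/
lemma isSmoothEmbedding_level (hN : IsConeGauge N)
    (Φ : {x | N x = 1} → (V ≃L[ℝ] EuclideanSpace ℝ (Fin k) × ℝ)) (hΦ : ∀ x, Φ x x = (0, 1)) :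
    letI := levelChartedSpace hN Φ hΦ
    Manifold.IsSmoothEmbedding (𝓡 k) 𝓘(ℝ, V) ∞ (Subtype.val : {x | N x = 1} → V) := by
  let _ := levelChartedSpace hN Φ hΦ
  have := isManifold_level hN Φ hΦ
  refine ⟨Manifold.IsImmersionOfComplement.isImmersion (F := ℝ) fun x => ?_, Topology.IsEmbedding.subtypeVal⟩
  -- Composing with the inverse of Φ gives a chart with values in V, the model space of the target.
  let e := (sliceChart hN (Φ x)).trans (Φ x).symm.toHomeomorph.toOpenPartialHomeomorph
  refine Manifold.IsImmersionAtOfComplement.mk_of_continuousAt continuous_subtype_val.continuousAt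
    (Φ x).symm (chartAt _ x) e (mem_chart_source _ x) ?_ (IsManifold.chart_mem_maximalAtlas x) ?_ ?_
  · have h1 : N x = 1 := x.2
    refine ⟨⟨?_, ?_⟩, trivial⟩
    · simp [hΦ]
    · simp [h1]
  · refine StructureGroupoid.mem_maximalAtlas_of_mem_groupoid _ ?_
    refine mem_groupoid_of_pregroupoid.2 ⟨?_, ?_⟩
    · have h1 : ContDiffOn ℝ ∞ e e.source :=
        (Φ x).symm.contDiff.comp_contDiffOn ((contDiffOn_sliceChart hN (Φ x)).mono fun y hy => hy.1)
      simpa [contDiffPregroupoid] using h1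
    · have h1 : ContDiffOn ℝ ∞ e.symm e.target :=
        (contDiffOn_sliceChart_symm hN (Φ x)).comp (Φ x).contDiff.contDiffOn fun y hy => hy.2
      simpa [contDiffPregroupoid] using h1
  · intro h hh
    have h0 : 0 < N ((Φ x).symm (h, 1)) := by
      rw [OpenPartialHomeomorph.extend_target] at hh
      exact hh.1
    have h1 : N ((N ((Φ x).symm (h, 1)))⁻¹ • (Φ x).symm (h, 1)) = 1 := by
      rw [hN.smul _ (inv_pos.2 h0), inv_mul_cancel₀ h0.ne']
    change (Φ x).symm (((Φ x) (levelPoint hN x ((Φ x).symm (h, 1)))).2⁻¹ •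
      ((Φ x) (levelPoint hN x ((Φ x).symm (h, 1)))).1,
      N (levelPoint hN x ((Φ x).symm (h, 1))) - 1) = (Φ x).symm (h, 0)
    rw [coe_levelPoint hN x h0, h1, map_smul, ContinuousLinearEquiv.apply_symm_apply]
    simp [smul_smul, h0.ne']

end Level

end

noncomputable section

/-! ### Quotients of cones by a dilation -/

section Circle

attribute [local instance] finrank_real_complex_fact'

/-- A branch of the angle on the circle, in turns, which is smooth near `θ₀`. -/
def circleAngle (θ₀ θ : Circle) : ℝ :=
  (Complex.arg θ₀ + Complex.arg (θ * θ₀⁻¹ : Circle)) / (2 * Real.pi)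

lemma exp_circleAngle (θ₀ θ : Circle) : Circle.exp (2 * Real.pi * circleAngle θ₀ θ) = θ := by
  rw [circleAngle, mul_div_cancel₀ _ (by positivity), Circle.exp_add, Circle.exp_arg,
    Circle.exp_arg, mul_comm, inv_mul_cancel_right]

/-- At θ₀ the argument is evaluated at θ₀ θ₀⁻¹ = 1, away from the branch cut. -/
lemma contMDiffAt_circleAngle (θ₀ : Circle) :
    ContMDiffAt (𝓡 1) 𝓘(ℝ, ℝ) ∞ (circleAngle θ₀) θ₀ := by
  have h1 : ContMDiff (𝓡 1) 𝓘(ℝ, ℂ) ∞ (fun θ : Circle => (θ : ℂ)) := contMDiff_coe_sphere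
  have h2 : ContMDiff (𝓡 1) (𝓡 1) ∞ (fun θ : Circle => θ * θ₀⁻¹) :=
    contMDiff_id.mul contMDiff_const
  have h3 : ContDiffAt ℝ ∞ Complex.arg ((θ₀ * θ₀⁻¹ : Circle) : ℂ) := by
    have h4 : ContDiffAt ℝ ∞ Complex.log ((θ₀ * θ₀⁻¹ : Circle) : ℂ) :=
      (Complex.contDiffAt_log (by simp)).restrict_scalars ℝ
    have h5 := Complex.imCLM.contDiff.contDiffAt.comp _ h4
    exact h5.congr_of_eventuallyEq (Filter.Eventually.of_forall fun z => (Complex.log_im z).symm)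
  have h4 : ContDiff ℝ ∞ fun t : ℝ => (Complex.arg θ₀ + t) / (2 * Real.pi) := by fun_prop
  exact h4.contMDiff.contMDiffAt.comp θ₀ (h3.contMDiffAt.comp θ₀ ((h1.comp h2).contMDiffAt))

end Circle

/-! ### The quotient of a cone by a dilation is a level set times a circle -/

section ConeQuotient

variable {V : Type*} [NormedAddCommGroup V] [NormedSpace ℝ V] {k : ℕ} {N : V → ℝ} {r : ℝ}
  {E : Type*} [NormedAddCommGroup E] [NormedSpace ℝ E]
  {X : Type*} [TopologicalSpace X] [ChartedSpace E X] {W : TopologicalSpace.Opens V}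

/-- `p` presents `X` as the quotient of the cone `0 < N` by the dilation `x ↦ r x`. -/
structure IsConeQuotient (N : V → ℝ) (r : ℝ) (p : W → X) : Prop where
  mem_iff : ∀ x, x ∈ W ↔ 0 < N x
  contMDiff : ContMDiff 𝓘(ℝ, V) 𝓘(ℝ, E) ∞ p
  surjective : Function.Surjective p
  eq_iff : ∀ x y, p x = p y ↔ ∃ m : ℤ, (y : V) = r ^ m • (x : V)
  exists_section : ∀ q, ∃ σ : X → V, ContMDiffAt 𝓘(ℝ, E) 𝓘(ℝ, V) ∞ σ q ∧
    ∀ᶠ q' in 𝓝 q, ∃ h : σ q' ∈ W, p ⟨σ q', h⟩ = q'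

variable {p : W → X}

/-- The projection of the cone to the product of the level set with the circle. -/
def coneToProd (hN : IsConeGauge N) (x₀ : {x | N x = 1}) (r : ℝ) (x : V) :
    {x | N x = 1} × Circle :=
  (levelPoint hN x₀ x, Circle.exp (2 * Real.pi * (Real.log (N x) / Real.log r)))

/-- Multiplication by r^m keeps the ray, hence the level point, and adds the integer m to log N /
log r, a whole number of turns. -/
lemma coneToProd_zpow_smul (hN : IsConeGauge N) (x₀ : {x | N x = 1}) (hr : 0 < r) (hr1 : r < 1)
    {x : V} (hx : 0 < N x) (m : ℤ) : coneToProd hN x₀ r (r ^ m • x) = coneToProd hN x₀ r x := by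
  have hm : 0 < r ^ m := zpow_pos hr m
  have h1 : N (r ^ m • x) = r ^ m * N x := hN.smul _ hm x
  have h2 : 0 < N (r ^ m • x) := by rw [h1]; positivity
  have hlog : Real.log r ≠ 0 := (Real.log_neg hr hr1).ne
  refine Prod.ext (Subtype.ext ?_) ?_
  · simp only [coneToProd]
    rw [coe_levelPoint hN x₀ h2, coe_levelPoint hN x₀ hx, h1, smul_smul]
    congr 1
    field_simp
  · simp only [coneToProd]
    rw [Circle.exp_eq_exp]
    refine ⟨m, ?_⟩
    rw [h1, Real.log_mul hm.ne' hx.ne', Real.log_zpow]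
    field_simp
    ring

lemma continuousAt_levelPoint (hN : IsConeGauge N) (x₀ : {x | N x = 1}) {x : V} (hx : 0 < N x) :
    ContinuousAt (levelPoint hN x₀) x := by
  rw [Topology.IsInducing.subtypeVal.continuousAt_iff]
  have h1 : ContinuousAt (fun x => (N x)⁻¹ • x) x :=
    (hN.continuous.continuousAt.inv₀ hx.ne').smul continuousAt_id
  refine h1.congr ?_
  filter_upwards [(isOpen_lt continuous_const hN.continuous).mem_nhds hx] with y hy
  exact (coe_levelPoint hN x₀ hy).symm

lemma contMDiffAt_coneToProd [ChartedSpace (EuclideanSpace ℝ (Fin k)) {x | N x = 1}]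
    [IsManifold (𝓡 k) ∞ {x | N x = 1}]
    (hval : Manifold.IsSmoothEmbedding (𝓡 k) 𝓘(ℝ, V) ∞ (Subtype.val : {x | N x = 1} → V))
    (hN : IsConeGauge N) (x₀ : {x | N x = 1}) {x : V} (hx : 0 < N x) :
    ContMDiffAt 𝓘(ℝ, V) ((𝓡 k).prod (𝓡 1)) ∞ (coneToProd hN x₀ r) x := by
  refine ContMDiffAt.prodMk ?_ ?_
  · rw [ContMDiffAt.iff_comp_isImmersionAt (hval.isImmersion.isImmersionAt _)]
    refine ⟨continuousAt_levelPoint hN x₀ hx, ?_⟩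
    have h1 : ContDiffAt ℝ ∞ (fun x => (N x)⁻¹ • x) x :=
      ((hN.contDiffAt x hx).inv hx.ne').smul contDiffAt_id
    refine h1.contMDiffAt.congr_of_eventuallyEq ?_
    filter_upwards [(isOpen_lt continuous_const hN.continuous).mem_nhds hx] with y hy
    exact coe_levelPoint hN x₀ hy
  · refine contMDiff_circleExp.contMDiffAt.comp x ?_
    have h1 : ContDiffAt ℝ ∞ (fun x => 2 * Real.pi * (Real.log (N x) / Real.log r)) x :=
      contDiffAt_const.mul (((hN.contDiffAt x hx).log hx.ne').div_const _)
    exact h1.contMDiffAt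

namespace IsConeQuotient

lemma rpow_smul_mem (hp : IsConeQuotient (E := E) N r p) (hN : IsConeGauge N) (hr : 0 < r) (t : ℝ)
    (y : {x | N x = 1}) : r ^ t • (y : V) ∈ W := by
  have h1 : N y = 1 := y.2
  rw [hp.mem_iff, hN.smul _ (by positivity), h1]
  positivity

/-- The point of the quotient below `r ^ t • y`. -/
def ofProd (hp : IsConeQuotient (E := E) N r p) (hN : IsConeGauge N) (hr : 0 < r) (t : ℝ)
    (y : {x | N x = 1}) : X :=
  p ⟨r ^ t • (y : V), hp.rpow_smul_mem hN hr t y⟩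

lemma ofProd_congr (hp : IsConeQuotient (E := E) N r p) (hN : IsConeGauge N) (hr : 0 < r) {t t' : ℝ}
    (h : Circle.exp (2 * Real.pi * t) = Circle.exp (2 * Real.pi * t')) (y : {x | N x = 1}) :
    hp.ofProd hN hr t y = hp.ofProd hN hr t' y := by
  obtain ⟨m, hm⟩ := Circle.exp_eq_exp.1 h.symm
  have h1 : t' = m + t := by
    have := Real.pi_pos
    apply mul_left_cancel₀ Real.two_pi_pos.ne'
    linarith
  refine (hp.eq_iff _ _).2 ⟨m, ?_⟩
  simp only [h1, Real.rpow_add hr, Real.rpow_intCast, smul_smul]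

lemma contMDiff_ofProd [ChartedSpace (EuclideanSpace ℝ (Fin k)) {x | N x = 1}]
    [IsManifold (𝓡 k) ∞ {x | N x = 1}]
    (hval : Manifold.IsSmoothEmbedding (𝓡 k) 𝓘(ℝ, V) ∞ (Subtype.val : {x | N x = 1} → V))
    (hp : IsConeQuotient (E := E) N r p) (hN : IsConeGauge N) (hr : 0 < r) :
    ContMDiff ((𝓡 k).prod (𝓡 1)) 𝓘(ℝ, E) ∞ fun w : {x | N x = 1} × Circle =>
      hp.ofProd hN hr (circleAngle 1 w.2) w.1 := by
  rintro ⟨y₀, θ₀⟩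
  -- Changing the branch of the angle changes t by an integer and not the point of the quotient, so
  -- near θ₀ the branch smooth at θ₀ may be used.
  have h0 : (fun w : {x | N x = 1} × Circle => hp.ofProd hN hr (circleAngle 1 w.2) w.1) =
      fun w => hp.ofProd hN hr (circleAngle θ₀ w.2) w.1 := by
    funext w
    exact hp.ofProd_congr hN hr (by rw [exp_circleAngle, exp_circleAngle]) _
  rw [h0]
  refine hp.contMDiff.contMDiffAt.comp (y₀, θ₀) ?_
  have h1 : ContMDiffAt ((𝓡 k).prod (𝓡 1)) 𝓘(ℝ, ℝ) ∞
      (fun w : {x | N x = 1} × Circle => r ^ circleAngle θ₀ w.2) (y₀, θ₀) := by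
    have h2 : ContDiff ℝ ∞ fun t : ℝ => r ^ t := contDiff_const.rpow contDiff_id fun _ => hr.ne'
    exact h2.contMDiff.contMDiffAt.comp _
      ((contMDiffAt_circleAngle θ₀).comp (y₀, θ₀) contMDiffAt_snd)
  have h2 : ContMDiffAt ((𝓡 k).prod (𝓡 1)) 𝓘(ℝ, V) ∞
      (fun w : {x | N x = 1} × Circle => r ^ circleAngle θ₀ w.2 • (w.1 : V)) (y₀, θ₀) :=
    h1.smul (hval.isImmersion.contMDiff.contMDiffAt.comp (y₀, θ₀) contMDiffAt_fst)
  rw [ContMDiffAt.iff_comp_isImmersionAt ((Manifold.IsImmersion.of_opens W).isImmersionAt _)]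
  refine ⟨?_, h2⟩
  rw [Topology.IsInducing.subtypeVal.continuousAt_iff]
  exact h2.continuousAt

/-- The quotient of a cone by a dilation is the product of a level set and a circle. -/
theorem nonempty_diffeomorph [ChartedSpace (EuclideanSpace ℝ (Fin k)) {x | N x = 1}]
    [IsManifold (𝓡 k) ∞ {x | N x = 1}]
    (hval : Manifold.IsSmoothEmbedding (𝓡 k) 𝓘(ℝ, V) ∞ (Subtype.val : {x | N x = 1} → V))
    (hp : IsConeQuotient (E := E) N r p) (hN : IsConeGauge N) (hr : 0 < r) (hr1 : r < 1)
    (x₀ : {x | N x = 1}) :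
    Nonempty (X ≃ₘ⟮𝓘(ℝ, E), (𝓡 k).prod (𝓡 1)⟯ ({x | N x = 1} × Circle)) := by
  -- An arbitrary set-theoretic lift defines the forward map; `hind` shows that the choice is
  -- immaterial, so smooth local sections can replace it when smoothness is checked.
  choose l hl using hp.surjective
  have hlog : Real.log r ≠ 0 := (Real.log_neg hr hr1).ne
  have hpos : ∀ x : W, 0 < N x := fun x => (hp.mem_iff x).1 x.2
  have hind : ∀ x : W, coneToProd hN x₀ r (l (p x)) = coneToProd hN x₀ r x := by
    intro x
    obtain ⟨m, hm⟩ := (hp.eq_iff _ _).1 (hl (p x)).symm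
    rw [hm, coneToProd_zpow_smul hN x₀ hr hr1 (hpos x)]
  refine ⟨⟨⟨fun q => coneToProd hN x₀ r (l q),
    fun w => hp.ofProd hN hr (circleAngle 1 w.2) w.1, ?_, ?_⟩, ?_, ?_⟩⟩
  · intro q
    have h1 : hp.ofProd hN hr (circleAngle 1 (coneToProd hN x₀ r (l q)).2)
        (coneToProd hN x₀ r (l q)).1 =
        hp.ofProd hN hr (Real.log (N (l q)) / Real.log r) (levelPoint hN x₀ (l q)) :=
      hp.ofProd_congr hN hr (exp_circleAngle _ _) _
    refine (h1.trans ?_).trans (hl q)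
    have h2 : 0 < N (l q) := hpos _
    refine congrArg p (Subtype.ext ?_)
    change r ^ (Real.log (N (l q)) / Real.log r) • (levelPoint hN x₀ (l q) : V) = l q
    rw [coe_levelPoint hN x₀ h2, Real.rpow_def_of_pos hr, mul_div_cancel₀ _ hlog,
      Real.exp_log h2, smul_smul, mul_inv_cancel₀ h2.ne', one_smul]
  · rintro ⟨y, θ⟩
    have hy : N y = 1 := y.2
    have ht : 0 < r ^ circleAngle 1 θ := by positivity
    have h1 : N (r ^ circleAngle 1 θ • (y : V)) = r ^ circleAngle 1 θ := by
      rw [hN.smul _ ht, hy, mul_one]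
    refine (hind _).trans (Prod.ext (Subtype.ext ?_) ?_)
    · change (levelPoint hN x₀ (r ^ circleAngle 1 θ • (y : V)) : V) = y
      rw [coe_levelPoint hN x₀ (by rwa [h1]), h1, smul_smul, inv_mul_cancel₀ ht.ne', one_smul]
    · change Circle.exp (2 * Real.pi *
        (Real.log (N (r ^ circleAngle 1 θ • (y : V))) / Real.log r)) = θ
      rw [h1, Real.log_rpow hr, mul_div_cancel_right₀ _ hlog, exp_circleAngle]
  · intro q
    obtain ⟨σ, hσ, hev⟩ := hp.exists_section q
    have h1 : 0 < N (σ q) := by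
      obtain ⟨h, -⟩ := hev.self_of_nhds
      exact (hp.mem_iff _).1 h
    refine ((contMDiffAt_coneToProd (r := r) hval hN x₀ h1).comp q hσ).congr_of_eventuallyEq ?_
    filter_upwards [hev] with q' ⟨h, hq'⟩
    conv_lhs => rw [← hq']
    exact hind _
  · exact hp.contMDiff_ofProd hval hN hr

theorem diffeoProdCircle (hk : Module.finrank ℝ V = k + 1)
    (hp : IsConeQuotient (E := E) N r p) (hN : IsConeGauge N) (hr : 0 < r) (hr1 : r < 1)
    (x₀ : {x | N x = 1}) : DiffeoProdCircle k {x | N x = 1} (E := E) X := by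
  have h1 : ∀ x : {x | N x = 1}, ∃ Φ : V ≃L[ℝ] EuclideanSpace ℝ (Fin k) × ℝ, Φ x = (0, 1) :=
    fun x => exists_equiv_apply_eq hk (hN.ne_zero (by rw [show N x = 1 from x.2]; simp))
  choose Φ hΦ using h1
  let _ := levelChartedSpace hN Φ hΦ
  have := isManifold_level hN Φ hΦ
  exact ⟨levelChartedSpace hN Φ hΦ, this, isSmoothEmbedding_level hN Φ hΦ,
    hp.nonempty_diffeomorph (isSmoothEmbedding_level hN Φ hΦ) hN hr hr1 x₀⟩

end IsConeQuotient

end ConeQuotient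

end

noncomputable section

/-! ### The three gauges, and real coordinates for the form -/

section Gauge

variable {V : Type*} [NormedAddCommGroup V] [NormedSpace ℝ V]

lemma isConeGauge_sqrt {q : V → ℝ} (hc : Continuous q)
    (hq : ∀ t : ℝ, 0 < t → ∀ x, q (t • x) = t ^ 2 * q x)
    (hs : ∀ x, 0 < q x → ContDiffAt ℝ ∞ q x) : IsConeGauge fun x => √(q x) where
  continuous := Real.continuous_sqrt.comp hc
  smul t ht x := by
    rw [hq t ht, Real.sqrt_mul (sq_nonneg t), Real.sqrt_sq ht.le]
  contDiffAt x hx := by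
    have hx' := Real.sqrt_pos.1 hx
    exact (hs x hx').sqrt hx'.ne'

lemma isConeGauge_pseudoNorm (n s : ℕ) : IsConeGauge (pseudoNorm n s) := by
  rw [show pseudoNorm n s = fun z => √|hermQ n s z| from funext (pseudoNorm_eq n s)]
  refine isConeGauge_sqrt (continuous_hermQ n s).abs (fun t ht z => ?_) fun z hz => ?_
  · rw [← Complex.coe_smul t z, hermQ_smul, Complex.norm_real, Real.norm_eq_abs, abs_mul, sq_abs,
      abs_of_nonneg (sq_nonneg t)]
  · exact (contDiff_hermQ n s).contDiffAt.abs (abs_pos.1 hz)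

lemma contDiff_realForm (ν m : ℕ) : ContDiff ℝ ∞ fun x => realForm ν m x x := by
  unfold realForm
  fun_prop

lemma realForm_smul (ν m : ℕ) (t : ℝ) (x : EuclideanSpace ℝ (Fin m)) :
    realForm ν m (t • x) (t • x) = t ^ 2 * realForm ν m x x := by
  simp only [realForm, Finset.mul_sum, PiLp.smul_apply, smul_eq_mul]
  exact Finset.sum_congr rfl fun j _ => by ring

lemma isConeGauge_realForm (ν m : ℕ) : IsConeGauge fun x => √(realForm ν m x x) :=
  isConeGauge_sqrt (contDiff_realForm ν m).continuous (fun t _ x => realForm_smul ν m t x)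
    fun _ _ => (contDiff_realForm ν m).contDiffAt

lemma isConeGauge_neg_realForm (ν m : ℕ) : IsConeGauge fun x => √(-realForm ν m x x) :=
  isConeGauge_sqrt (contDiff_realForm ν m).continuous.neg
    (fun t _ x => by rw [realForm_smul, mul_neg]) fun _ _ => (contDiff_realForm ν m).neg.contDiffAt

/-- `ℝ^{2n}` is identified with `ℂⁿ` by pairing consecutive coordinates. -/
lemma exists_equiv_hermQ {n m : ℕ} (hm : n * 2 = m) (s : ℕ) :
    ∃ L : EuclideanSpace ℝ (Fin m) ≃L[ℝ] Cn n,
      ∀ x, hermQ n s (L x) = realForm (2 * s) m x x := by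
  subst hm
  let L : EuclideanSpace ℝ (Fin (n * 2)) ≃ₗ[ℝ] Cn n :=
    ((WithLp.linearEquiv 2 ℝ (Fin (n * 2) → ℝ)).trans
      (LinearEquiv.funCongrLeft ℝ ℝ finProdFinEquiv)).trans (realCoords n).symm
  refine ⟨L.toContinuousLinearEquiv, fun x => ?_⟩
  have h1 : ∀ j, (L x) j = ⟨x (finProdFinEquiv (j, 0)), x (finProdFinEquiv (j, 1))⟩ := fun j => rfl
  change hermQ n s (L x) = _
  rw [realForm, ← finProdFinEquiv.sum_comp, Fintype.sum_prod_type, hermQ]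
  refine Finset.sum_congr rfl fun j _ => ?_
  have h2 : ∀ i : Fin 2, signEps (2 * s) (finProdFinEquiv (j, i)) = signEps s j := by
    intro i
    have : ((finProdFinEquiv (j, i) : Fin (n * 2)) : ℕ) < 2 * s ↔ (j : ℕ) < s := by
      rw [finProdFinEquiv_apply_val]
      have := i.isLt
      simp only
      omega
    simp only [signEps, this]
  rw [Fin.sum_univ_two, h2, h2, h1, ← Complex.normSq_eq_norm_sq, Complex.normSq_apply]
  ring

end Gauge

/-! ### Restriction of a cone quotient to an open subcone -/

section Restrict

variable {V : Type*} [NormedAddCommGroup V] [NormedSpace ℝ V] {N : V → ℝ} {r : ℝ}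
  {V' : Type*} [NormedAddCommGroup V'] [NormedSpace ℝ V'] {N' : V' → ℝ}
  {E : Type*} [NormedAddCommGroup E] [NormedSpace ℝ E]
  {X : Type*} [TopologicalSpace X] [ChartedSpace E X] [IsManifold 𝓘(ℝ, E) ∞ X]
  {W : TopologicalSpace.Opens V} {p : W → X}

/-- Passes from the whole quotient to one component, while moving the cone to ℝ^{2n} by a linear
isomorphism, where the standard hyperquadrics live. -/
lemma IsConeQuotient.restrict (hp : IsConeQuotient (E := E) N r p) (L : V' ≃L[ℝ] V)
    (W' : TopologicalSpace.Opens V') (hW' : ∀ y, y ∈ W' ↔ 0 < N' y) (hL : ∀ y ∈ W', L y ∈ W)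
    (O : TopologicalSpace.Opens X) (hO : ∀ x : W, p x ∈ O ↔ L.symm x ∈ W') :
    IsConeQuotient (E := E) N' r fun y : W' =>
      (⟨p ⟨L y, hL y y.2⟩, (hO _).2 (by simp)⟩ : O) where
  mem_iff := hW'
  contMDiff := by
    have h2 : ContMDiff 𝓘(ℝ, V') 𝓘(ℝ, V) ∞ fun y : W' => L (y : V') :=
      L.contDiff.contMDiff.comp contMDiff_subtype_val
    have h3 : ContMDiff 𝓘(ℝ, V') 𝓘(ℝ, V) ∞ fun y : W' => (⟨L y, hL y y.2⟩ : W) :=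
      (ContMDiff.iff_comp_isImmersion (Manifold.IsImmersion.of_opens W)).2
        ⟨h2.continuous.subtype_mk _, h2⟩
    have h4 := hp.contMDiff.comp h3
    exact (ContMDiff.iff_comp_isImmersion (Manifold.IsImmersion.of_opens O)).2
        ⟨h4.continuous.subtype_mk _, h4⟩
  surjective := by
    rintro ⟨q, hq⟩
    obtain ⟨x, rfl⟩ := hp.surjective q
    refine ⟨⟨L.symm x, (hO x).1 hq⟩, Subtype.ext (congrArg p (Subtype.ext ?_))⟩
    simp
  eq_iff x y := by
    rw [Subtype.mk.injEq, hp.eq_iff]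
    refine exists_congr fun m => ?_
    simp only
    rw [← map_smul, L.injective.eq_iff]
  exists_section := by
    rintro ⟨q, hq⟩
    obtain ⟨σ, hσ, hev⟩ := hp.exists_section q
    refine ⟨fun q' => L.symm (σ q'), ?_, ?_⟩
    · exact L.symm.contDiff.contMDiff.contMDiffAt.comp _
        (hσ.comp (⟨q, hq⟩ : O) contMDiff_subtype_val.contMDiffAt)
    · filter_upwards [(continuous_subtype_val.tendsto (⟨q, hq⟩ : O)).eventually hev] with q' hq'
      obtain ⟨h, h1⟩ := hq'
      refine ⟨(hO ⟨σ q', h⟩).1 (by rw [h1]; exact q'.2), Subtype.ext ?_⟩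
      simp only [ContinuousLinearEquiv.apply_symm_apply]
      exact h1

end Restrict

/-! ### The positive and negative parts of the quotient -/

section Hopf

variable {n s : ℕ} {lam : ℂ} {hlam : lam ≠ 0}
  [IsCancelSMul (hopfGroup n s lam hlam) (coneCompl n s)]
  [ContinuousConstSMul (hopfGroup n s lam hlam) (coneCompl n s)]
  [ProperlyDiscontinuousSMul (hopfGroup n s lam hlam) (coneCompl n s)]

lemma isConeQuotient_hopfProj {r : ℝ} (hr : lam = r) :
    IsConeQuotient (E := Cn n) (pseudoNorm n s) r (hopfProj n s lam hlam) where
  mem_iff x := (pseudoNorm_pos_iff n s x).symm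
  contMDiff := (isLocalDiffeomorph_hopfProj (𝕜 := ℝ) (k := ∞)).contMDiff
  surjective := hopfProj_surjective
  eq_iff x y := by
    rw [hopfProj_eq_iff]
    refine exists_congr fun m => ?_
    rw [hr, ← Complex.coe_smul (r ^ m), Complex.ofReal_zpow]
  exists_section q := by
    have := isManifold_hopfQuot (n := n) (s := s) (hlam := hlam) (𝕜 := ℝ) (k := ∞)
    refine ⟨chartAt (Cn n) q, contMDiffAt_extChartAt, ?_⟩
    filter_upwards [(chartAt (Cn n) q).open_source.mem_nhds (mem_chart_source _ q)] with q' hq'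
    exact isLiftChart_chartAt q q' hq'

/-- The image of the cone where the Hermitian form is positive. -/
def hopfPosPart (n s : ℕ) (lam : ℂ) (hlam : lam ≠ 0)
    [IsCancelSMul (hopfGroup n s lam hlam) (coneCompl n s)]
    [ContinuousConstSMul (hopfGroup n s lam hlam) (coneCompl n s)]
    [ProperlyDiscontinuousSMul (hopfGroup n s lam hlam) (coneCompl n s)] :
    TopologicalSpace.Opens (HopfQuot n s lam hlam) where
  carrier := hopfProj n s lam hlam '' {z | 0 < hermQ n s z}
  is_open' := isLocalHomeomorph_hopfProj.isOpenMap _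
    (isOpen_lt continuous_const ((continuous_hermQ n s).comp continuous_subtype_val))

/-- The image of the cone where the Hermitian form is negative. -/
def hopfNegPart (n s : ℕ) (lam : ℂ) (hlam : lam ≠ 0)
    [IsCancelSMul (hopfGroup n s lam hlam) (coneCompl n s)]
    [ContinuousConstSMul (hopfGroup n s lam hlam) (coneCompl n s)]
    [ProperlyDiscontinuousSMul (hopfGroup n s lam hlam) (coneCompl n s)] :
    TopologicalSpace.Opens (HopfQuot n s lam hlam) where
  carrier := hopfProj n s lam hlam '' {z | hermQ n s z < 0}
  is_open' := isLocalHomeomorph_hopfProj.isOpenMap _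
    (isOpen_lt ((continuous_hermQ n s).comp continuous_subtype_val) continuous_const)

lemma hopfProj_mem_hopfPosPart (z : coneCompl n s) :
    hopfProj n s lam hlam z ∈ hopfPosPart n s lam hlam ↔ 0 < hermQ n s z := by
  refine ⟨?_, fun h => ⟨z, h, rfl⟩⟩
  rintro ⟨w, hw, hwz⟩
  obtain ⟨m, hm⟩ := hopfProj_eq_iff.1 hwz
  rw [hm, hermQ_smul]
  have : 0 < ‖lam ^ m‖ := norm_pos_iff.2 (zpow_ne_zero m hlam)
  exact mul_pos (by positivity) hw

lemma hopfProj_mem_hopfNegPart (z : coneCompl n s) :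
    hopfProj n s lam hlam z ∈ hopfNegPart n s lam hlam ↔ hermQ n s z < 0 := by
  refine ⟨?_, fun h => ⟨z, h, rfl⟩⟩
  rintro ⟨w, hw, hwz⟩
  obtain ⟨m, hm⟩ := hopfProj_eq_iff.1 hwz
  rw [hm, hermQ_smul]
  have : 0 < ‖lam ^ m‖ := norm_pos_iff.2 (zpow_ne_zero m hlam)
  exact mul_neg_of_pos_of_neg (by positivity) hw

lemma mem_hopfNegPart_iff (x : HopfQuot n s lam hlam) :
    x ∈ hopfNegPart n s lam hlam ↔ x ∉ hopfPosPart n s lam hlam := by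
  obtain ⟨z, rfl⟩ := hopfProj_surjective x
  rw [hopfProj_mem_hopfNegPart, hopfProj_mem_hopfPosPart, not_lt]
  exact ⟨le_of_lt, fun h => h.lt_of_ne ((mem_coneCompl_iff n s z).1 z.2)⟩

lemma coe_hopfPosPart : (hopfPosPart n s lam hlam : Set (HopfQuot n s lam hlam)) =
    hopfProj n s lam hlam '' {z | (z : Cn n) ∈ posCone n s \ nullCone₀ n s} := by
  refine congrArg (hopfProj n s lam hlam '' ·) (Set.ext fun z => ?_)
  simp only [Set.mem_ofPred_eq, Set.mem_sdiff, mem_posCone_iff, mem_nullCone₀_iff]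
  exact ⟨fun h => ⟨h.le, h.ne'⟩, fun h => h.1.lt_of_ne' h.2⟩

lemma coe_hopfNegPart : (hopfNegPart n s lam hlam : Set (HopfQuot n s lam hlam)) =
    hopfProj n s lam hlam '' {z | (z : Cn n) ∈ negCone n s \ nullCone₀ n s} := by
  refine congrArg (hopfProj n s lam hlam '' ·) (Set.ext fun z => ?_)
  simp only [Set.mem_ofPred_eq, Set.mem_sdiff, mem_negCone_iff, mem_nullCone₀_iff]
  exact ⟨fun h => ⟨h.le, h.ne⟩, fun h => h.1.lt_of_ne h.2⟩

lemma isConnected_image_hopfProj {A : Set (Cn n)} (hA : IsConnected A)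
    (hA' : A ⊆ coneCompl n s) : IsConnected (hopfProj n s lam hlam '' {z | (z : Cn n) ∈ A}) := by
  refine IsConnected.image ?_ _ isLocalHomeomorph_hopfProj.continuous.continuousOn
  have h : IsConnected (Subtype.val ⁻¹' A : Set (coneCompl n s)) :=
    hA.preimage_of_isOpenMap Subtype.val_injective (coneCompl n s).isOpen.isOpenMap_subtype_val
      (by rwa [Subtype.range_val])
  exact h

lemma isConnected_hopfPosPart (hsn : s < n) :
    IsConnected (hopfPosPart n s lam hlam : Set (HopfQuot n s lam hlam)) :=
  isConnected_image_hopfProj (isConnected_hermQ_pos hsn)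
    fun z hz => (mem_coneCompl_iff n s z).2 (ne_of_gt hz)

lemma isConnected_hopfNegPart (hs : 0 < s) (hsn : s < n) :
    IsConnected (hopfNegPart n s lam hlam : Set (HopfQuot n s lam hlam)) :=
  isConnected_image_hopfProj (isConnected_hermQ_neg hs hsn)
    fun z hz => (mem_coneCompl_iff n s z).2 (ne_of_lt hz)

lemma hopfPosPart_ne_hopfNegPart (hsn : s < n) :
    hopfPosPart n s lam hlam ≠ hopfNegPart n s lam hlam := by
  intro h
  obtain ⟨x, hx⟩ := (isConnected_hopfPosPart (hlam := hlam) hsn).nonempty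
  exact (mem_hopfNegPart_iff x).1 (h ▸ hx) hx

/-- The two parts are open and complementary, hence clopen; being also connected, they are the
components. -/
lemma range_connectedComponent (hs : 0 < s) (hsn : s < n) :
    Set.range (connectedComponent : HopfQuot n s lam hlam → Set (HopfQuot n s lam hlam)) =
      {(hopfPosPart n s lam hlam : Set (HopfQuot n s lam hlam)),
        (hopfNegPart n s lam hlam : Set (HopfQuot n s lam hlam))} := by
  have hc : (hopfNegPart n s lam hlam : Set (HopfQuot n s lam hlam)) =
      (hopfPosPart n s lam hlam : Set (HopfQuot n s lam hlam))ᶜ := Set.ext mem_hopfNegPart_iff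
  have h1 : IsClopen (hopfPosPart n s lam hlam : Set (HopfQuot n s lam hlam)) :=
    ⟨isOpen_compl_iff.1 (hc ▸ (hopfNegPart n s lam hlam).isOpen), (hopfPosPart n s lam hlam).isOpen⟩
  have h2 : IsClopen (hopfNegPart n s lam hlam : Set (HopfQuot n s lam hlam)) := hc ▸ h1.compl
  have hpos : ∀ x ∈ hopfPosPart n s lam hlam,
      connectedComponent x = (hopfPosPart n s lam hlam : Set (HopfQuot n s lam hlam)) := fun x hx =>
    (h1.connectedComponent_subset hx).antisymm
      ((isConnected_hopfPosPart hsn).isPreconnected.subset_connectedComponent hx)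
  have hneg : ∀ x ∈ hopfNegPart n s lam hlam,
      connectedComponent x = (hopfNegPart n s lam hlam : Set (HopfQuot n s lam hlam)) := fun x hx =>
    (h2.connectedComponent_subset hx).antisymm
      ((isConnected_hopfNegPart hs hsn).isPreconnected.subset_connectedComponent hx)
  ext A
  constructor
  · rintro ⟨x, rfl⟩
    by_cases hx : x ∈ hopfPosPart n s lam hlam
    · exact Or.inl (hpos x hx)
    · exact Or.inr (hneg x ((mem_hopfNegPart_iff x).2 hx))
  · rintro (rfl | rfl)
    · obtain ⟨x, hx⟩ := (isConnected_hopfPosPart (hlam := hlam) hsn).nonempty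
      exact ⟨x, hpos x hx⟩
    · obtain ⟨x, hx⟩ := (isConnected_hopfNegPart (hlam := hlam) hs hsn).nonempty
      exact ⟨x, hneg x hx⟩

end Hopf

end

noncomputable section

/-! ### Noncompactness and the product decompositions -/

section Conclusion

/-- A hyperbola in the plane of one negative and one positive coordinate shows that the level set Q
= 1 is unbounded. -/
lemma exists_hermQ_eq_one {n s : ℕ} (hs : 0 < s) (hsn : s < n) (t : ℝ) :
    ∃ z : Cn n, hermQ n s z = 1 ∧ |t| ≤ ‖z‖ := by
  let a : Fin n := ⟨0, hs.trans hsn⟩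
  let b : Fin n := ⟨s, hsn⟩
  have hab : a ≠ b := fun h => hs.ne (Fin.mk.inj h)
  refine ⟨EuclideanSpace.single a (t : ℂ) + EuclideanSpace.single b ((√(t ^ 2 + 1) : ℝ) : ℂ),
    ?_, ?_⟩
  · rw [hermQ, Fintype.sum_eq_add a b hab fun j hj => by simp [hj.1, hj.2]]
    have h1 : signEps s a = -1 := by simp [signEps, a, hs]
    have h2 : signEps s b = 1 := by simp [signEps, b]
    have h3 : 0 ≤ t ^ 2 + 1 := by positivity
    simp only [PiLp.add_apply, PiLp.single_apply, hab, hab.symm, if_true, if_false, h1, h2, add_zero,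
      zero_add, Complex.norm_real, Real.norm_eq_abs, sq_abs, Real.sq_sqrt h3]
    ring
  · refine le_trans ?_ (PiLp.norm_apply_le _ a)
    simp [hab]

variable {n s : ℕ} {lam : ℂ} {hlam : lam ≠ 0}

lemma exists_hermQ_eq_neg_one {n s : ℕ} (hs : 0 < s) (hsn : s < n) :
    ∃ z : Cn n, hermQ n s z = -1 := by
  let a : Fin n := ⟨0, hs.trans hsn⟩
  refine ⟨EuclideanSpace.single a 1, ?_⟩
  rw [hermQ, Fintype.sum_eq_single a fun j hj => by simp [hj]]
  simp [signEps, a, hs]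

variable
  [IsCancelSMul (hopfGroup n s lam hlam) (coneCompl n s)]
  [ContinuousConstSMul (hopfGroup n s lam hlam) (coneCompl n s)]
  [ProperlyDiscontinuousSMul (hopfGroup n s lam hlam) (coneCompl n s)]

lemma not_compactSpace_hopfQuot (hs : 0 < s) (hsn : s < n) :
    ¬ CompactSpace (HopfQuot n s lam hlam) := by
  intro hcomp
  choose l hl using hopfProj_surjective (n := n) (s := s) (hlam := hlam)
  -- Numerator and denominator both scale by |λ^m|², so g descends to the quotient. It is unbounded
  -- already on Q = 1, where it equals ‖z‖².
  let g : Cn n → ℝ := fun z => ‖z‖ ^ 2 / |hermQ n s z|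
  have hg : ∀ z, g (l (hopfProj n s lam hlam z)) = g z := by
    intro z
    obtain ⟨m, hm⟩ := hopfProj_eq_iff.1 (hl (hopfProj n s lam hlam z)).symm
    have hm0 : ‖lam ^ m‖ ≠ 0 := norm_ne_zero_iff.2 (zpow_ne_zero m hlam)
    simp only [g, hm, hermQ_smul, norm_smul, mul_pow, abs_mul, abs_pow, abs_norm]
    rw [mul_div_mul_left _ _ (pow_ne_zero 2 hm0)]
  have hc : Continuous fun x : HopfQuot n s lam hlam => g (l x) := by
    have hq : Topology.IsQuotientMap (hopfProj n s lam hlam) :=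
      (isLocalHomeomorph_hopfProj (hlam := hlam)).isOpenMap.isQuotientMap
        isLocalHomeomorph_hopfProj.continuous hopfProj_surjective
    rw [hq.continuous_iff]
    have h1 : (fun x : HopfQuot n s lam hlam => g (l x)) ∘ hopfProj n s lam hlam =
        fun z : coneCompl n s => g z := funext hg
    rw [h1]
    exact (continuous_subtype_val.norm.pow 2).div
      ((continuous_hermQ n s).comp continuous_subtype_val).abs
      fun z => abs_ne_zero.2 ((mem_coneCompl_iff n s z).1 z.2)
  obtain ⟨C, hC⟩ := (isCompact_range hc).bddAbove
  obtain ⟨z, hz, hCz⟩ := exists_hermQ_eq_one hs hsn (|C| + 1)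
  have h1 := hC ⟨hopfProj n s lam hlam ⟨z, (mem_coneCompl_iff n s z).2 (by simp [hz])⟩, rfl⟩
  simp only [hg] at h1
  simp only [g, hz, abs_one, div_one] at h1
  rw [abs_of_pos (by positivity)] at hCz
  nlinarith [le_abs_self C, abs_nonneg C]

lemma diffeoProdCircle_hopfQuot (hs : 0 < s) (hsn : s < n) {r : ℝ} (hr : 0 < r) (hr1 : r < 1)
    (hlr : lam = r) :
    DiffeoProdCircle (2 * n - 1) (sigmaSet n s) (E := Cn n) (HopfQuot n s lam hlam) := by
  obtain ⟨z, hz, -⟩ := exists_hermQ_eq_one hs hsn 0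
  have hk : Module.finrank ℝ (Cn n) = 2 * n - 1 + 1 := by
    rw [(realCoords n).finrank_eq, Module.finrank_fintype_fun_eq_card]
    simp
    omega
  exact (isConeQuotient_hopfProj hlr).diffeoProdCircle hk (isConeGauge_pseudoNorm n s) hr hr1
    ⟨z, by simp [pseudoNorm_eq, hz]⟩

lemma pseudoSphere_one (N ν : ℕ) :
    pseudoSphere N ν 1 = {x | √(realForm ν (N + 1) x x) = 1} := by
  ext x
  simp [pseudoSphere, Real.sqrt_eq_one]

lemma pseudoHyperbolic_one (N ν : ℕ) :
    pseudoHyperbolic N ν 1 = {x | √(-realForm (ν + 1) (N + 1) x x) = 1} := by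
  ext x
  simp [pseudoHyperbolic, Real.sqrt_eq_one, neg_eq_iff_eq_neg]

lemma diffeoProdCircle_hopfPosPart (hs : 0 < s) (hsn : s < n) {r : ℝ} (hr : 0 < r) (hr1 : r < 1)
    (hlr : lam = r) :
    DiffeoProdCircle (2 * n - 1) (pseudoSphere (2 * n - 1) (2 * s) 1) (E := Cn n)
      (hopfPosPart n s lam hlam) := by
  have := isManifold_hopfQuot (n := n) (s := s) (hlam := hlam) (𝕜 := ℝ) (k := ∞)
  obtain ⟨L, hL⟩ := exists_equiv_hermQ (n := n) (m := 2 * n - 1 + 1) (by omega) s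
  have hpos : ∀ y, 0 < √(realForm (2 * s) (2 * n - 1 + 1) y y) ↔ 0 < hermQ n s (L y) := fun y => by
    rw [Real.sqrt_pos, hL]
  have hN := isConeGauge_realForm (2 * s) (2 * n - 1 + 1)
  let W : TopologicalSpace.Opens (EuclideanSpace ℝ (Fin (2 * n - 1 + 1))) :=
    ⟨{y | 0 < √(realForm (2 * s) (2 * n - 1 + 1) y y)},
      isOpen_lt continuous_const hN.continuous⟩
  have hp := (isConeQuotient_hopfProj (n := n) (s := s) (hlam := hlam) hlr).restrict L W
    (fun y => Iff.rfl) (fun y hy => (mem_coneCompl_iff n s _).2 ((hpos y).1 hy).ne')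
    (hopfPosPart n s lam hlam) fun z => by
      rw [hopfProj_mem_hopfPosPart]
      exact (by simp : _ ↔ 0 < hermQ n s (L (L.symm z))).trans (hpos _).symm
  obtain ⟨z, hz, -⟩ := exists_hermQ_eq_one hs hsn 0
  rw [pseudoSphere_one]
  exact hp.diffeoProdCircle (by simp) hN hr hr1 ⟨L.symm z, by simp [← hL, hz]⟩

lemma diffeoProdCircle_hopfNegPart (hs : 0 < s) (hsn : s < n) {r : ℝ} (hr : 0 < r) (hr1 : r < 1)
    (hlr : lam = r) :
    DiffeoProdCircle (2 * n - 1) (pseudoHyperbolic (2 * n - 1) (2 * s - 1) 1) (E := Cn n)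
      (hopfNegPart n s lam hlam) := by
  have := isManifold_hopfQuot (n := n) (s := s) (hlam := hlam) (𝕜 := ℝ) (k := ∞)
  obtain ⟨L, hL⟩ := exists_equiv_hermQ (n := n) (m := 2 * n - 1 + 1) (by omega) s
  -- The definition of the pseudohyperbolic space takes one negative square more than its index, so
  -- 2s - 1 yields 2s; the truncated subtraction is harmless as s > 0.
  rw [pseudoHyperbolic_one, show 2 * s - 1 + 1 = 2 * s by omega]
  have hpos : ∀ y, 0 < √(-realForm (2 * s) (2 * n - 1 + 1) y y) ↔ hermQ n s (L y) < 0 :=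
    fun y => by rw [Real.sqrt_pos, hL, neg_pos]
  have hN := isConeGauge_neg_realForm (2 * s) (2 * n - 1 + 1)
  let W : TopologicalSpace.Opens (EuclideanSpace ℝ (Fin (2 * n - 1 + 1))) :=
    ⟨{y | 0 < √(-realForm (2 * s) (2 * n - 1 + 1) y y)},
      isOpen_lt continuous_const hN.continuous⟩
  have hp := (isConeQuotient_hopfProj (n := n) (s := s) (hlam := hlam) hlr).restrict L W
    (fun y => Iff.rfl) (fun y hy => (mem_coneCompl_iff n s _).2 ((hpos y).1 hy).ne)
    (hopfNegPart n s lam hlam) fun z => by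
      rw [hopfProj_mem_hopfNegPart]
      exact (by simp : _ ↔ hermQ n s (L (L.symm z)) < 0).trans (hpos _).symm
  obtain ⟨z, hz⟩ := exists_hermQ_eq_neg_one hs hsn
  exact hp.diffeoProdCircle (by simp) hN hr hr1 ⟨L.symm z, by simp [← hL, hz]⟩

end Conclusion

end

theorem theorem2 (n s : ℕ) (hs : 0 < s) (hsn : s < n) (lam : ℂ) (hlam : lam ≠ 0)
    (hlam1 : ‖lam‖ ≠ 1) :
    -- `G_λ` acts freely and properly discontinuously, by biholomorphic transformations
    (∀ γ : hopfGroup n s lam hlam, ∀ z : coneCompl n s, γ • z = z → γ = 1) ∧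
    (∀ γ : hopfGroup n s lam hlam,
      ContMDiff 𝓘(ℂ, Cn n) 𝓘(ℂ, Cn n) ω (fun z : coneCompl n s => γ • z)) ∧
    ∃ (_ : IsCancelSMul (hopfGroup n s lam hlam) (coneCompl n s))
      (_ : ContinuousConstSMul (hopfGroup n s lam hlam) (coneCompl n s))
      (_ : ProperlyDiscontinuousSMul (hopfGroup n s lam hlam) (coneCompl n s)),
    -- the quotient is a complex manifold, and the projection is locally biholomorphic
    T2Space (HopfQuot n s lam hlam) ∧
    SecondCountableTopology (HopfQuot n s lam hlam) ∧
    ∃ (_ : IsManifold 𝓘(ℂ, Cn n) ω (HopfQuot n s lam hlam))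
      (_ : IsManifold 𝓘(ℝ, Cn n) ∞ (HopfQuot n s lam hlam)),
    IsLocalDiffeomorph 𝓘(ℂ, Cn n) 𝓘(ℂ, Cn n) ω (hopfProj n s lam hlam) ∧
    -- `|z|_{s,n}^{-2} (flat metric)` descends to an indefinite l.c.K. metric of index `2s`
    (∃ g : BilinField n (HopfQuot n s lam hlam),
      (∀ (z : coneCompl n s) (u v : Cn n),
        g (hopfProj n s lam hlam z)
          (mfderiv 𝓘(ℝ, Cn n) 𝓘(ℝ, Cn n) (hopfProj n s lam hlam) z u)
          (mfderiv 𝓘(ℝ, Cn n) 𝓘(ℝ, Cn n) (hopfProj n s lam hlam) z v) =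
        (pseudoNorm n s z ^ 2)⁻¹ * flatMetric n s u v) ∧
      IsIndefiniteLCK g (2 * s)) ∧
    frontier (posCone n s) = nullCone₀ n s ∧
    frontier (negCone n s) = nullCone₀ n s ∧
    -- the case `0 < λ < 1`
    (∀ r : ℝ, 0 < r → r < 1 → lam = (r : ℂ) →
      DiffeoProdCircle (2 * n - 1) (sigmaSet n s) (E := Cn n) (HopfQuot n s lam hlam) ∧
      ¬ CompactSpace (HopfQuot n s lam hlam) ∧
      ∃ Ωp Ωm : TopologicalSpace.Opens (HopfQuot n s lam hlam),
        (Ωp : Set (HopfQuot n s lam hlam)) =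
          hopfProj n s lam hlam '' {z | (z : Cn n) ∈ posCone n s \ nullCone₀ n s} ∧
        (Ωm : Set (HopfQuot n s lam hlam)) =
          hopfProj n s lam hlam '' {z | (z : Cn n) ∈ negCone n s \ nullCone₀ n s} ∧
        Ωp ≠ Ωm ∧
        Set.range (connectedComponent : HopfQuot n s lam hlam → Set (HopfQuot n s lam hlam)) =
          {(Ωp : Set (HopfQuot n s lam hlam)), (Ωm : Set (HopfQuot n s lam hlam))} ∧
        DiffeoProdCircle (2 * n - 1) (pseudoSphere (2 * n - 1) (2 * s) 1) (E := Cn n) Ωp ∧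
        DiffeoProdCircle (2 * n - 1) (pseudoHyperbolic (2 * n - 1) (2 * s - 1) 1)
          (E := Cn n) Ωm) := by
  refine ⟨hopfGroup_free hlam1, contMDiff_hopfGroup_smul, isCancelSMul_hopfGroup hlam1,
    continuousConstSMul_hopfGroup, properlyDiscontinuousSMul_hopfGroup hlam1, ?_⟩
  have := isCancelSMul_hopfGroup (n := n) (s := s) (hlam := hlam) hlam1
  have := continuousConstSMul_hopfGroup (n := n) (s := s) (hlam := hlam)
  have := properlyDiscontinuousSMul_hopfGroup (n := n) (s := s) (hlam := hlam) hlam1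
  have h1 := isManifold_hopfQuot (n := n) (s := s) (hlam := hlam) (𝕜 := ℂ) (k := ω)
  have h2 := isManifold_hopfQuot (n := n) (s := s) (hlam := hlam) (𝕜 := ℝ) (k := ∞)
  refine ⟨t2Space_of_properlyDiscontinuousSMul_of_t2Space,
    ContinuousConstSMul.secondCountableTopology, h1, h2, isLocalDiffeomorph_hopfProj,
    ⟨hopfMetric, hopfMetric_mfderiv, isIndefiniteLCK_hopfMetric hs hsn⟩,
    frontier_posCone hs hsn, frontier_negCone hsn, fun r hr hr1 hlr => ?_⟩
  exact ⟨diffeoProdCircle_hopfQuot hs hsn hr hr1 hlr, not_compactSpace_hopfQuot hs hsn,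
    hopfPosPart n s lam hlam, hopfNegPart n s lam hlam, coe_hopfPosPart, coe_hopfNegPart,
    hopfPosPart_ne_hopfNegPart hsn, range_connectedComponent hs hsn,
    diffeoProdCircle_hopfPosPart hs hsn hr hr1 hlr, diffeoProdCircle_hopfNegPart hs hsn hr hr1 hlr⟩
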